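/- **Setting.** Let $0\le\theta<1$, $d\in\mathbb R$, and consider two chains $\mathcal R_1=\mathbb Z$ and $\mathcal R_2=(1-\theta)\mathbb Z$ with one orbital per site; $\Omega=\mathcal R_1\sqcup\mathcal R_2$ (disjoint union). Put $a_1=1$, $a_2=1-\theta$. For $\epsilon\in\mathbb R$, $t,\nu,l>0$ and an interlayer hopping function $h=h_{\nu,l}:\mathbb R\to\mathbb R$, let $H_{\theta,d}$ be the bounded operator $(H\psi)(R)=\sum_{R'\in\Omega}H(R,R')\psi(R')$ on $\ell^2(\Omega)$, where for $R,R'\in\mathcal R_i$ one has $H(R,R')=t$ if $R-R'=\pm a_i$, $H(R,R')=\epsilon$ if $R=R'$, and $H(R,R')=0$ otherwise; and for $R\in\mathcal R_i$, $R'\in\mathcal R_j$, $i\ne j$, $H(R,R')=h(|r|)$ with $r=R+d(-\delta_{i1}+\delta_{i2})-R'$. Let $g$ be a real polynomial of degree $n_{\rm poly}\ge 2$ (for instance, any non-constant even polynomial). The smoothed local density of states is $$\rho_\theta(d,E)=\sum_{R\in\mathcal R_2,\ R+d\in\Gamma_{2,d}} g(H_{\theta,d}-E)(R,R),\qquad \Gamma_{2,d}=\{d+(1-\theta)\beta:\beta\in[0,1)\}.$$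 Let $N_E>n_{\rm poly}$ and $E_{\min}<E_{\max}$. For $N_d\ge 2$ put $d_i=(i-1)/N_d$ $(1\le i\le N_d)$ and $E_j=E_{\min}+(j-1)(E_{\max}-E_{\min})/N_E$ $(1\le j\le N_E)$. The image of the model with parameters $p=(\epsilon,t,\nu,l)$ is $\mathcal T_\theta(p)=(\rho_\theta(d_i,E_j))_{i,j}\in\mathbb R^{N_d\times N_E}$. For a set $\mathcal P\subset\mathbb R\times\mathbb R_+^3$ (where $\mathbb R_+=(0,\infty)$) let $\mathcal K:\mathcal P\to\mathbb R^{N_d\times N_E}$, $\mathcal K(p)=\mathcal T_0(p)$. When $\mathcal K$ is one-to-one, the twist operator is $\tilde{\mathcal L}_\theta=\mathcal T_\theta\circ\mathcal K^{-1}:\operatorname{range}(\mathcal K)\to\mathbb R^{N_d\times N_E}$. Let $\|\cdot\|$ be the Euclidean norm on $\mathbb R^{N_d\times N_E}\cong\mathbb R^{N_dN_E}$. **Theorem (universal approximation for twist operators, fixed $\theta$).** Assume one of the following. 1. $h_{\nu,l}(x)=\nu e^{-|x|/l}$, the set $\mathcal P\subset\mathbb R\times\mathbb R_+^3$ is compact,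 $N_d\ge3$, and $\{0,\frac14,\frac12\}\subset\{d_1,\dots,d_{N_d}\}$. 2. $h_{\nu,l}(x)=\nu f(x/l)\,\chi_{[-r_0,r_0+1)}(x)$, where $r_0>1$ is an integer and $f:\mathbb R\to\mathbb R$ is positive, even, extends to an analytic function on a domain $\mathcal D$ with $\mathbb R\subset\mathcal D\subset\mathbb C$, and satisfies $\lim_{r\to\infty} f(r/l)/f(r/l')=0$ for all $0<l<l'$; the set $\mathcal P\subset\mathbb R\times\mathbb R_+^3$ is finite; and $N_d>N_0$, where $N_0$ is a positive integer (whose existence is part of the claim) that depends only on $f,r_0,\mathcal P,g,N_E,E_{\min},E_{\max}$. Then $\mathcal K$ is one-to-one, so that $\tilde{\mathcal L}_\theta$ is well defined for every $0\le\theta<1$. Moreover, for every $0\le\theta<1$, every continuous non-polynomial function $\sigma:\mathbb R\to\mathbb R$ and every $\varepsilon>0$ there exist $k\in\mathbb N_{>0}$, $A\in\mathbb R^{k\times N_dN_E}$, $b\in\mathbb R^k$ and $C\in\mathbb R^{N_dN_E\times k}$ such that $$\sup_{x\in\operatorname{range}(\mathcal K)}\|\tilde{\mathcal L}_\theta(x)-C\cdot(\sigma\circ(A\cdot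 x+b))\|<\varepsilon,$$ where $\sigma$ is applied componentwise. -/

import Mathlib

namespace TwistLDOS

/-! ### The coupled chain and its tight-binding Hamiltonian -/

/-- Orbitals of the coupled chain, one per unit cell: `Sum.inl n` is the site `n * a₁` of layer one
and `Sum.inr n` is the site `n * a₂` of layer two, where `a₁ = 1` and `a₂ = 1 - θ`.  The union of
the two lattices is a disjoint union of labels (for `θ = 0` both lattices are `ℤ`). -/
abbrev Site : Type := ℤ ⊕ ℤ

/-- The Hilbert space `ℓ²(Ω)` of wave functions. -/
abbrev WaveSpace : Type := lp (fun _ : Site => ℂ) 2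

/-- Intralayer hopping energy between cells whose indices differ by `k`. -/
noncomputable def intralayer (ε t : ℝ) (k : ℤ) : ℝ :=
  if k = 1 then t else if k = -1 then t else if k = 0 then ε else 0

/-- The hopping energies `H(R, R')` at mismatch `θ` and interlayer shift `d`, for the intralayer
parameters `ε, t` and the interlayer hopping function `h`.  The interlayer entries are `h(|r|)`
with `r = R + d (-δ_{i1} + δ_{i2}) - R'`. -/
noncomputable def hopping (θ d ε t : ℝ) (h : ℝ → ℝ) : Site → Site → ℝ
  | Sum.inl m, Sum.inl n => intralayer ε t (m - n)
  | Sum.inr m, Sum.inr n => intralayer ε t (m - n)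
  | Sum.inl m, Sum.inr n => h |(m : ℝ) - d - n * (1 - θ)|
  | Sum.inr m, Sum.inl n => h |(m : ℝ) * (1 - θ) + d - n|

/-- The bounded operator `T` acts on `ℓ²` through the infinite matrix `M`:
`(T ψ)(R) = ∑_{R'} M(R, R') ψ(R')`, the series converging absolutely. -/
def ActsBy (M : Site → Site → ℝ) (T : WaveSpace →L[ℂ] WaveSpace) : Prop :=
  ∀ (ψ : WaveSpace) (R : Site), HasSum (fun R' => (M R R' : ℂ) * ψ R') (T ψ R)

open Classical in
/-- The bounded operator on `ℓ²(Ω)` with matrix `M`.  (It is the zero operator if `M` does not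
define a bounded operator; `actsBy_hamiltonian` below shows that this does not happen for hopping
functions with exponential decay.) -/
noncomputable def matrixOperator (M : Site → Site → ℝ) : WaveSpace →L[ℂ] WaveSpace :=
  if H : ∃ T, ActsBy M T then H.choose else 0

/-- The tight-binding Hamiltonian `H_{θ,d}`. -/
noncomputable def hamiltonian (θ d ε t : ℝ) (h : ℝ → ℝ) : WaveSpace →L[ℂ] WaveSpace :=
  matrixOperator (hopping θ d ε t h)

/-! ### Local density of states -/

/-- The shifted unit cell `Γ_{2,d}` of layer two. -/
def homeCell (θ d : ℝ) : Set ℝ := {x | ∃ β ∈ Set.Ico (0 : ℝ) 1, x = d + (1 - θ) * β}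

/-- (Indices of) the orbitals of layer two that lie in `Γ_{2,d}`. -/
def homeOrbitals (θ d : ℝ) : Set ℤ := {n | (n : ℝ) * (1 - θ) + d ∈ homeCell θ d}

/-- The matrix entry `A(R, R')` of an operator on `ℓ²(Ω)`. -/
noncomputable def entry (A : WaveSpace →L[ℂ] WaveSpace) (R R' : Site) : ℂ :=
  A (lp.single 2 R' (1 : ℂ)) R

/-- The operator `g(H - E)` for a real polynomial `g`. -/
noncomputable def polyOfShifted (g : Polynomial ℝ) (H : WaveSpace →L[ℂ] WaveSpace) (E : ℝ) :
    WaveSpace →L[ℂ] WaveSpace :=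
  Polynomial.aeval (H - (E : ℂ) • (1 : WaveSpace →L[ℂ] WaveSpace)) (g.map (algebraMap ℝ ℂ))

/-- The smoothed stacking-dependent local density of states `ρ_θ(d, E)`, for the model with
intralayer parameters `ε, t` and interlayer hopping function `h`.  (The entries are real, as the
hopping energies and the coefficients of `g` are real.) -/
noncomputable def ldos (g : Polynomial ℝ) (θ ε t : ℝ) (h : ℝ → ℝ) (d E : ℝ) : ℝ :=
  ∑ᶠ n ∈ homeOrbitals θ d,
    (entry (polyOfShifted g (hamiltonian θ d ε t h) E) (Sum.inr n) (Sum.inr n)).re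

/-- The grid of shifts `0, 1/N, …, (N-1)/N`. -/
noncomputable def shiftGrid (Nd : ℕ) (i : Fin Nd) : ℝ := (i : ℝ) / Nd

/-- The grid of `NE` equally spaced energies in the window `[Emin, Emax)`. -/
noncomputable def energyGrid (NE : ℕ) (Emin Emax : ℝ) (j : Fin NE) : ℝ :=
  Emin + (j : ℝ) * (Emax - Emin) / NE

/-- The space `ℝ^{N_d × N_E}` of images, with the Euclidean norm. -/
abbrev Image (Nd NE : ℕ) : Type := EuclideanSpace ℝ (Fin Nd × Fin NE)

/-- Model parameters `(ε, t, ν, l)`. -/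
abbrev Params : Type := ℝ × ℝ × ℝ × ℝ

/-- The image `ϱ_θ` of the local density of states on the grid, as a function of the model
parameters `p = (ε, t, ν, l)`; `hop ν l` is the interlayer hopping function with parameters
`ν, l`. -/
noncomputable def ldosImage (g : Polynomial ℝ) (hop : ℝ → ℝ → ℝ → ℝ) (Nd NE : ℕ)
    (Emin Emax θ : ℝ) (p : Params) : Image Nd NE :=
  WithLp.toLp 2 fun ij =>
    ldos g θ p.1 p.2.1 (hop p.2.2.1 p.2.2.2) (shiftGrid Nd ij.1) (energyGrid NE Emin Emax ij.2)

/-- The exponential interlayer hopping function `x ↦ ν exp(-|x| / l)`. -/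
noncomputable def expHop (ν l x : ℝ) : ℝ := ν * Real.exp (-|x| / l)

/-- The truncated interlayer hopping function `x ↦ ν f(x / l) χ_{[-r₀, r₀ + 1)}(x)`. -/
noncomputable def truncHop (f : ℝ → ℝ) (r₀ : ℕ) (ν l x : ℝ) : ℝ :=
  ν * f (x / l) * (Set.Ico (-(r₀ : ℝ)) (r₀ + 1)).indicator 1 x

/-- The parameters `ε` (arbitrary) and `t, ν, l` (positive): `P ⊆ ℝ × ℝ₊³`. -/
def Admissible (P : Set Params) : Prop :=
  ∀ p ∈ P, 0 < p.2.1 ∧ 0 < p.2.2.1 ∧ 0 < p.2.2.2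

/-! ### The twist operator and two-layer networks -/

/-- The map `𝒦 : P → ℝ^{N_d × N_E}` from parameters to untwisted (`θ = 0`) images. -/
noncomputable def untwistedMap (g : Polynomial ℝ) (hop : ℝ → ℝ → ℝ → ℝ) (Nd NE : ℕ)
    (Emin Emax : ℝ) (P : Set Params) : P → Image Nd NE :=
  fun p => ldosImage g hop Nd NE Emin Emax 0 p

/-- The twist operator `𝒯_θ ∘ 𝒦⁻¹ : range 𝒦 → ℝ^{N_d × N_E}`, which takes the image at `θ = 0` to
the image at `θ` for the same model parameters. -/
noncomputable def twistOperator (g : Polynomial ℝ) (hop : ℝ → ℝ → ℝ → ℝ) (Nd NE : ℕ)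
    (Emin Emax θ : ℝ) (P : Set Params)
    (hK : Function.Injective (untwistedMap g hop Nd NE Emin Emax P)) :
    Set.range (untwistedMap g hop Nd NE Emin Emax P) → Image Nd NE :=
  fun x => ldosImage g hop Nd NE Emin Emax θ ((Equiv.ofInjective _ hK).symm x : P)

/-- The two-layer network `x ↦ C · (σ ∘ (A · x + b))`. -/
noncomputable def twoLayerNet {ι : Type*} [Fintype ι] {k : ℕ} (σ : ℝ → ℝ)
    (A : Matrix (Fin k) ι ℝ) (b : Fin k → ℝ) (C : Matrix ι (Fin k) ℝ)
    (x : EuclideanSpace ℝ ι) : EuclideanSpace ℝ ι :=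
  WithLp.toLp 2 (C.mulVec (σ ∘ (A.mulVec x.ofLp + b)))

/-- `L : X → ℝ^ι` can be approximated by two-layer networks to any accuracy, uniformly on `X`, for
every continuous non-polynomial activation function.  The supremum is taken in `[0, ∞]`. -/
def ApproximableByTwoLayerNets {ι : Type*} [Fintype ι] {X : Set (EuclideanSpace ℝ ι)}
    (L : X → EuclideanSpace ℝ ι) : Prop :=
  ∀ σ : ℝ → ℝ, Continuous σ → (¬ ∃ q : Polynomial ℝ, ∀ x, σ x = q.eval x) →
    ∀ ε : ℝ, 0 < ε →
      ∃ (k : ℕ) (A : Matrix (Fin k) ι ℝ) (b : Fin k → ℝ) (C : Matrix ι (Fin k) ℝ), 0 < k ∧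
        (⨆ x : X, ENNReal.ofReal ‖L x - twoLayerNet σ A b C x‖) < ENNReal.ofReal ε

/-! ### The definitions are meaningful -/

/-- Only the orbital at the origin of layer two lies in the home cell. -/
theorem homeOrbitals_eq {θ : ℝ} (hθ : θ < 1) (d : ℝ) : homeOrbitals θ d = {0} := by
  have h1 : 0 < 1 - θ := by linarith
  ext n
  simp only [homeOrbitals, homeCell, Set.mem_ofPred_eq, Set.mem_singleton_iff, Set.mem_Ico]
  constructor
  · rintro ⟨β, ⟨h0, hlt⟩, h⟩
    have h2 : (n : ℝ) = β := by
      have : (1 - θ) * ((n : ℝ) - β) = 0 := by linarith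
      rcases mul_eq_zero.1 this with h' | h' <;> linarith
    rw [← h2] at h0 hlt
    have h3 : (0 : ℤ) ≤ n := by exact_mod_cast h0
    have h4 : n < 1 := by exact_mod_cast hlt
    omega
  · rintro rfl
    exact ⟨0, ⟨le_refl _, one_pos⟩, by simp⟩

/-- Schur test: a matrix with uniformly bounded absolute row and column sums defines a bounded
operator. -/
theorem exists_actsBy (M : Site → Site → ℝ) (C : ℝ)
    (hrow : ∀ i (s : Finset Site), ∑ j ∈ s, |M i j| ≤ C)
    (hcol : ∀ j (s : Finset Site), ∑ i ∈ s, |M i j| ≤ C) :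
    ∃ T, ActsBy M T := by
  have hC : 0 ≤ C := by simpa using hrow (Sum.inl 0) ∅
  have hsM : ∀ i, Summable fun j => |M i j| := fun i =>
    summable_of_sum_le (fun _ => abs_nonneg _) (hrow i)
  have hsum : ∀ (ψ : WaveSpace) i, Summable fun j => (M i j : ℂ) * ψ j := by
    intro ψ i
    refine Summable.of_norm_bounded (g := fun j => |M i j| * ‖ψ‖) ((hsM i).mul_right _) ?_
    intro j
    rw [norm_mul, Complex.norm_real, Real.norm_eq_abs]
    exact mul_le_mul_of_nonneg_left (lp.norm_apply_le_norm (by norm_num) ψ j) (abs_nonneg _)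
  have hfin : ∀ (ψ : WaveSpace) (s F : Finset Site),
      ∑ i ∈ s, ‖∑ j ∈ F, (M i j : ℂ) * ψ j‖ ^ 2 ≤ (C * ‖ψ‖) ^ 2 := by
    intro ψ s F
    have h1 : ∀ i, ‖∑ j ∈ F, (M i j : ℂ) * ψ j‖ ^ 2 ≤ C * ∑ j ∈ F, |M i j| * ‖ψ j‖ ^ 2 := by
      intro i
      have h2 : ‖∑ j ∈ F, (M i j : ℂ) * ψ j‖ ≤ ∑ j ∈ F, |M i j| * ‖ψ j‖ := by
        refine (norm_sum_le _ _).trans (le_of_eq (Finset.sum_congr rfl fun j _ => ?_))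
        rw [norm_mul, Complex.norm_real, Real.norm_eq_abs]
      have h3 : (∑ j ∈ F, |M i j| * ‖ψ j‖) ^ 2 ≤
          (∑ j ∈ F, |M i j|) * ∑ j ∈ F, |M i j| * ‖ψ j‖ ^ 2 := by
        refine Finset.sum_sq_le_sum_mul_sum_of_sq_le_mul F (fun _ _ => abs_nonneg _)
          (fun _ _ => by positivity) (fun j _ => le_of_eq (by ring))
      calc ‖∑ j ∈ F, (M i j : ℂ) * ψ j‖ ^ 2 ≤ (∑ j ∈ F, |M i j| * ‖ψ j‖) ^ 2 := by gcongr
        _ ≤ _ := h3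
        _ ≤ _ := mul_le_mul_of_nonneg_right (hrow i F)
          (Finset.sum_nonneg fun _ _ => by positivity)
    have h4 : ∑ j ∈ F, ‖ψ j‖ ^ 2 ≤ ‖ψ‖ ^ 2 := by
      have := lp.sum_rpow_le_norm_rpow (p := 2) (by norm_num) ψ F
      simpa using this
    calc ∑ i ∈ s, ‖∑ j ∈ F, (M i j : ℂ) * ψ j‖ ^ 2
        ≤ ∑ i ∈ s, C * ∑ j ∈ F, |M i j| * ‖ψ j‖ ^ 2 := Finset.sum_le_sum fun i _ => h1 i
      _ = C * ∑ j ∈ F, (∑ i ∈ s, |M i j|) * ‖ψ j‖ ^ 2 := by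
          rw [← Finset.mul_sum, Finset.sum_comm]
          simp_rw [Finset.sum_mul]
      _ ≤ C * ∑ j ∈ F, C * ‖ψ j‖ ^ 2 := by
          gcongr with j _
          exact hcol j s
      _ = C * C * ∑ j ∈ F, ‖ψ j‖ ^ 2 := by rw [← Finset.mul_sum, mul_assoc]
      _ ≤ C * C * ‖ψ‖ ^ 2 := by gcongr
      _ = (C * ‖ψ‖) ^ 2 := by ring
  have hlim : ∀ (ψ : WaveSpace) (s : Finset Site),
      ∑ i ∈ s, ‖∑' j, (M i j : ℂ) * ψ j‖ ^ 2 ≤ (C * ‖ψ‖) ^ 2 := by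
    intro ψ s
    refine le_of_tendsto (tendsto_finsetSum s fun i _ =>
      ((hsum ψ i).hasSum.norm.pow 2)) (Filter.Eventually.of_forall fun F => hfin ψ s F)
  have hmem : ∀ ψ : WaveSpace, Memℓp (fun i => ∑' j, (M i j : ℂ) * ψ j) 2 := by
    intro ψ
    refine memℓp_gen' (C := (C * ‖ψ‖) ^ 2) fun s => ?_
    simpa using hlim ψ s
  let T₀ : WaveSpace →ₗ[ℂ] WaveSpace :=
    { toFun := fun ψ => ⟨_, hmem ψ⟩
      map_add' := fun ψ φ => by
        ext i
        change ∑' j, (M i j : ℂ) * (ψ j + φ j) = _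
        simp_rw [mul_add]
        exact (hsum ψ i).tsum_add (hsum φ i)
      map_smul' := fun c ψ => by
        ext i
        change ∑' j, (M i j : ℂ) * (c * ψ j) = c * ∑' j, (M i j : ℂ) * ψ j
        rw [← tsum_mul_left]
        exact tsum_congr fun j => by ring }
  refine ⟨T₀.mkContinuous C fun ψ => ?_, fun ψ i => (hsum ψ i).hasSum⟩
  refine lp.norm_le_of_forall_sum_le (p := 2) (by norm_num) (by positivity) fun s => ?_
  have := hlim ψ s
  simp only [ENNReal.toReal_ofNat, Real.rpow_ofNat]
  exact this

/-- Exponentials are uniformly summable over shifted lattices. -/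
theorem exists_lattice_sum_bound {γ a : ℝ} (hγ : 0 < γ) (ha : 0 < a) :
    ∃ C, ∀ (x : ℝ) (s : Finset ℤ), ∑ n ∈ s, Real.exp (-γ * |x - n * a|) ≤ C := by
  set r : ℝ := Real.exp (-γ * a) with hr
  have hr0 : 0 < r := Real.exp_pos _
  have hr1 : r < 1 := Real.exp_lt_one_iff.2 (by nlinarith)
  have hS : Summable fun k : ℤ => r ^ k.natAbs := by
    refine Summable.of_nat_of_neg ?_ ?_ <;>
      simpa using summable_geometric_of_lt_one hr0.le hr1
  refine ⟨Real.exp (γ * a) * ∑' k : ℤ, r ^ k.natAbs, fun x s => ?_⟩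
  set m : ℤ := ⌊x / a⌋ with hm
  have h1 : ∀ n : ℤ, Real.exp (-γ * |x - n * a|) ≤ Real.exp (γ * a) * r ^ (n - m).natAbs := by
    intro n
    rw [hr, ← Real.exp_nat_mul, ← Real.exp_add]
    apply Real.exp_le_exp.2
    have hf1 : (m : ℝ) * a ≤ x := by
      have := Int.floor_le (x / a); rwa [le_div_iff₀ ha] at this
    have hf2 : x < ((m : ℝ) + 1) * a := by
      have := Int.lt_floor_add_one (x / a); rwa [div_lt_iff₀ ha] at this
    have hcast : (((n - m).natAbs : ℕ) : ℝ) = |(n : ℝ) - m| := by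
      rw [Nat.cast_natAbs]; push_cast; rfl
    rw [hcast]
    have h5 : |(n : ℝ) - m| * a ≤ |x - n * a| + a := by
      have : |(n : ℝ) - m| * a = |(n : ℝ) * a - m * a| := by
        rw [← sub_mul, abs_mul, abs_of_pos ha]
      rw [this]
      have h6 : |(n : ℝ) * a - m * a| ≤ |n * a - x| + |x - m * a| := abs_sub_le _ _ _
      have h7 : |x - m * a| ≤ a := by rw [abs_of_nonneg] <;> linarith
      rw [abs_sub_comm (n * a : ℝ) x] at h6
      linarith
    nlinarith
  calc ∑ n ∈ s, Real.exp (-γ * |x - n * a|)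
      ≤ ∑ n ∈ s, Real.exp (γ * a) * r ^ (n - m).natAbs := Finset.sum_le_sum fun n _ => h1 n
    _ = Real.exp (γ * a) * ∑ n ∈ s, r ^ (n - m).natAbs := by rw [Finset.mul_sum]
    _ ≤ _ := by
      gcongr
      have hS' : Summable fun n : ℤ => r ^ (n - m).natAbs :=
        (Equiv.subRight m).summable_iff (f := fun k : ℤ => r ^ k.natAbs) |>.2 hS
      refine (hS'.sum_le_tsum s fun _ _ => by positivity).trans (le_of_eq ?_)
      exact (Equiv.subRight m).tsum_eq (fun k : ℤ => r ^ k.natAbs)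

theorem intralayer_neg (ε t : ℝ) (k : ℤ) : intralayer ε t (-k) = intralayer ε t k := by
  unfold intralayer
  split_ifs <;> first | rfl | omega

theorem hopping_symm (θ d ε t : ℝ) (h : ℝ → ℝ) (R R' : Site) :
    hopping θ d ε t h R R' = hopping θ d ε t h R' R := by
  rcases R with m | m <;> rcases R' with n | n <;> simp only [hopping]
  · rw [← intralayer_neg, neg_sub]
  · rw [abs_sub_comm]; congr 2; ring
  · rw [abs_sub_comm]; congr 2; ring
  · rw [← intralayer_neg, neg_sub]

/-- If the interlayer hopping function decays exponentially, the Hamiltonian is a bounded operator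
on `ℓ²(Ω)` that acts through the hopping energies. -/
theorem actsBy_hamiltonian {θ : ℝ} (hθ : θ < 1) (d ε t : ℝ) {h : ℝ → ℝ} {h₀ γ : ℝ}
    (hγ : 0 < γ) (hh : ∀ x, |h x| ≤ h₀ * Real.exp (-γ * |x|)) :
    ActsBy (hopping θ d ε t h) (hamiltonian θ d ε t h) := by
  have key : ∃ T, ActsBy (hopping θ d ε t h) T := by
    have hh0 : 0 ≤ h₀ := by simpa using (abs_nonneg _).trans (hh 0)
    obtain ⟨C₁, hC₁⟩ := exists_lattice_sum_bound hγ one_pos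
    obtain ⟨C₂, hC₂⟩ := exists_lattice_sum_bound hγ (by linarith : 0 < 1 - θ)
    have hi : ∀ (m : ℤ) (s : Finset ℤ),
        ∑ n ∈ s, |intralayer ε t (m - n)| ≤ |t| + |t| + |ε| := by
      intro m s
      have hb : ∀ n : ℤ, |intralayer ε t (m - n)| ≤
          (if m - 1 = n then |t| else 0) + (if m + 1 = n then |t| else 0) +
            (if m = n then |ε| else 0) := by
        intro n
        unfold intralayer
        have := abs_nonneg t
        have := abs_nonneg ε
        split_ifs <;> first | omega | simp
      refine (Finset.sum_le_sum fun n _ => hb n).trans ?_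
      rw [Finset.sum_add_distrib, Finset.sum_add_distrib]
      simp only [Finset.sum_ite_eq]
      have := abs_nonneg t
      have := abs_nonneg ε
      gcongr <;> split_ifs <;> simp
    have hA : ∀ (x : ℝ) (s : Finset ℤ), ∑ n ∈ s, |h (|x - n * (1 - θ)|)| ≤ h₀ * C₂ := by
      intro x s
      calc _ ≤ ∑ n ∈ s, h₀ * Real.exp (-γ * |x - n * (1 - θ)|) :=
            Finset.sum_le_sum fun n _ => by simpa using hh |x - n * (1 - θ)|
        _ ≤ _ := by rw [← Finset.mul_sum]; gcongr; exact hC₂ x s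
    have hB : ∀ (x : ℝ) (s : Finset ℤ), ∑ n ∈ s, |h (|x - n|)| ≤ h₀ * C₁ := by
      intro x s
      calc _ ≤ ∑ n ∈ s, h₀ * Real.exp (-γ * |x - n * 1|) :=
            Finset.sum_le_sum fun n _ => by simpa using hh |x - n|
        _ ≤ _ := by rw [← Finset.mul_sum]; gcongr; exact hC₁ x s
    have hrow : ∀ i (s : Finset Site), ∑ j ∈ s, |hopping θ d ε t h i j| ≤
        (|t| + |t| + |ε|) + (h₀ * C₁ + h₀ * C₂) := by
      intro i s
      have p1 : 0 ≤ h₀ * C₁ := by simpa using hB 0 ∅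
      have p2 : 0 ≤ h₀ * C₂ := by simpa using hA 0 ∅
      rw [← Finset.toLeft_disjSum_toRight (u := s), Finset.sum_disjSum]
      rcases i with m | m <;> simp only [hopping]
      · have := hi m s.toLeft
        have := hA (m - d) s.toRight
        linarith
      · have := hi m s.toRight
        have := hB (m * (1 - θ) + d) s.toLeft
        linarith
    exact exists_actsBy _ _ hrow fun j s => by
      simpa only [hopping_symm θ d ε t h _ j] using hrow j s
  unfold hamiltonian matrixOperator
  rw [dif_pos key]
  exact key.choose_spec

/-- The twist operator takes the untwisted image of `p` to the twisted image of `p`. -/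
theorem twistOperator_apply (g : Polynomial ℝ) (hop : ℝ → ℝ → ℝ → ℝ) (Nd NE : ℕ)
    (Emin Emax θ : ℝ) (P : Set Params)
    (hK : Function.Injective (untwistedMap g hop Nd NE Emin Emax P)) (p : P) :
    twistOperator g hop Nd NE Emin Emax θ P hK
        ⟨untwistedMap g hop Nd NE Emin Emax P p, Set.mem_range_self p⟩ =
      ldosImage g hop Nd NE Emin Emax θ p := by
  unfold twistOperator
  rw [Equiv.ofInjective_symm_apply]

/-- The matrix entries of the Hamiltonian are the hopping energies. -/
theorem entry_of_actsBy {M : Site → Site → ℝ} {T : WaveSpace →L[ℂ] WaveSpace} (hT : ActsBy M T)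
    (R R' : Site) : entry T R R' = M R R' := by
  have h1 := hT (lp.single 2 R' (1 : ℂ)) R
  have h2 := hasSum_single (f := fun j => (M R j : ℂ) * (lp.single 2 R' (1 : ℂ) : WaveSpace) j) R'
    (fun j hj => by simp [lp.single_apply, hj])
  have h3 := h1.unique h2
  simpa [entry, lp.single_apply] using h3

theorem expHop_decay {ν l : ℝ} (hν : 0 < ν) (x : ℝ) :
    |expHop ν l x| ≤ ν * Real.exp (-(1 / l) * |x|) := by
  rw [expHop, abs_of_pos (by positivity)]
  exact le_of_eq (by congr 2; ring)

theorem truncHop_decay {f : ℝ → ℝ} (hf : Continuous f) (r₀ : ℕ) (ν l : ℝ) :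
    ∃ h₀, ∀ x, |truncHop f r₀ ν l x| ≤ h₀ * Real.exp (-1 * |x|) := by
  obtain ⟨B, hB⟩ := (isCompact_Icc (a := -(r₀ : ℝ)) (b := r₀ + 1)).exists_bound_of_continuousOn
    (f := fun x => ν * f (x / l)) (by fun_prop)
  have hB0 : 0 ≤ B := (norm_nonneg _).trans (hB 0 ⟨by simp, by positivity⟩)
  refine ⟨B * Real.exp (r₀ + 1), fun x => ?_⟩
  by_cases hx : x ∈ Set.Ico (-(r₀ : ℝ)) (r₀ + 1)
  · have h1 := hB x ⟨hx.1, hx.2.le⟩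
    have h2 : |x| ≤ r₀ + 1 := abs_le.2 ⟨by linarith [hx.1], hx.2.le⟩
    rw [truncHop, Set.indicator_of_mem hx, Pi.one_apply, mul_one, mul_assoc, ← Real.exp_add]
    have h3 : (1 : ℝ) ≤ Real.exp (r₀ + 1 + -1 * |x|) := Real.one_le_exp (by linarith)
    rw [Real.norm_eq_abs] at h1
    nlinarith
  · rw [truncHop, Set.indicator_of_notMem hx]
    simp only [mul_zero, abs_zero]
    positivity

end TwistLDOS

open TwistLDOS

/-!
The theorem has two independent halves: the untwisted image determines the parameters, and every
continuous map on a compact set of images is approximated by two-layer networks.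

**Identifiability.** By Taylor expansion (`ldos_eq_sum`), `g (H - E)(0, 0)` is a linear combination
of the Hasse derivatives of `g` at `-E`, with the moments `H ^ m (0, 0)` as coefficients.  Since
there are more than `deg g` energies, the moments of order one and two are determined
(`coeff_eq_zero_of_sum_hasseDeriv_eval_eq_zero`).  The first is `ε`; at `θ = 0` the second is
`ε ^ 2 + 2 t ^ 2 + ∑ n, h |d - n| ^ 2` (`hasSum_sq_hop`).  For exponential hopping the sum over `n`
is a pair of geometric series, and its values at `d = 0, 1/4, 1/2` give `l`, `ν` and `t`
(`eq_of_three_shifts`).  For truncated hopping the sum is, for `d` in `(0, 1)`, finite and analytic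
in `d`.  If the second moments of two parameters agreed on `(0, 1)`, their analytic continuations
would agree on the real line, where the limit `d → ∞` yields `t` and the ratio condition yields `l`
and `ν` (`eq_of_sum_sq_eq`).  So they differ on an open set of shifts, which all fine grids meet.  A
finite parameter set has finitely many pairs, so that one `N₀` suffices.

**Approximation.** The closed span of the neurons `σ (w · x + b)` contains, by moving averages and
differentiation in the dilation parameter, all `u ^ k * (Δ_h ^ k σ) (a u + b)` with `u = w · x`
(`pow_mul_ridge_iterate_fwdDiff_mem`).  At `a = 0` this is `u ^ k` times a constant, which is
nonzero for some `h`, `b` by Fréchet's characterization of polynomials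
(`exists_polynomial_of_fwdDiff_iter_eq_zero`).  So the closed span contains `exp (w · x)`, and the
Stone–Weierstrass theorem applies
(`topologicalClosure_span_ridge_eq_top`).  The twist operator is continuous because the parameter set is
compact and the Hamiltonian depends continuously on the parameters in the operator norm
(`continuousAt_hamiltonian_expHop`; for finite parameter sets continuity is trivial).
-/

/-! ### Functions with vanishing iterated differences -/

/-- Newton's forward difference formula: along an arithmetic progression, a function whose `k`-th
differences vanish is a polynomial. -/
theorem exists_polynomial_on_progression {f : ℝ → ℝ} {k : ℕ} {h : ℝ}
    (hf : ∀ b, (fwdDiff h)^[k] f b = 0) (y : ℝ) :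
    ∃ P : Polynomial ℝ, ∀ n : ℕ, f (y + n * h) = P.eval (n : ℝ) := by
  refine ⟨∑ j ∈ Finset.range k,
    Polynomial.C ((fwdDiff h)^[j] f y / j.factorial) * descPochhammer ℝ j, fun n => ?_⟩
  have hzero : ∀ j, k ≤ j → (fwdDiff h)^[j] f y = 0 := by
    intro j hj
    obtain ⟨i, rfl⟩ := Nat.exists_eq_add_of_le' hj
    rw [Function.iterate_add_apply, show (fwdDiff h)^[k] f = fun _ => 0 from funext hf]
    have : ∀ i : ℕ, (fwdDiff h)^[i] (fun _ : ℝ => (0 : ℝ)) = fun _ => 0 := by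
      intro i
      induction i with
      | zero => rfl
      | succ i ih => rw [Function.iterate_succ_apply', ih, fwdDiff_const]
    rw [this]
  have hterm : ∀ j, (n.choose j : ℕ) • (fwdDiff h)^[j] f y =
      (Polynomial.C ((fwdDiff h)^[j] f y / j.factorial) * descPochhammer ℝ j).eval (n : ℝ) := by
    intro j
    rw [Polynomial.eval_mul, Polynomial.eval_C, descPochhammer_eval_eq_descFactorial,
      Nat.descFactorial_eq_factorial_mul_choose, nsmul_eq_mul]
    have := Nat.factorial_ne_zero j
    push_cast
    field_simp
  rw [← nsmul_eq_mul, shift_eq_sum_fwdDiff_iter h f n y, Polynomial.eval_finsetSum]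
  simp_rw [hterm]
  -- the ranges `j ≤ n` and `j < k` carry the same nonzero terms
  have h1 : ∀ N, n + 1 ≤ N → k ≤ N → ∀ M, (M = n + 1 ∨ M = k) →
      ∑ j ∈ Finset.range M,
        (Polynomial.C ((fwdDiff h)^[j] f y / j.factorial) * descPochhammer ℝ j).eval (n : ℝ) =
      ∑ j ∈ Finset.range N,
        (Polynomial.C ((fwdDiff h)^[j] f y / j.factorial) * descPochhammer ℝ j).eval (n : ℝ) := by
    intro N hN1 hN2 M hM
    refine Finset.sum_subset (Finset.range_mono (by omega)) fun j _ hj => ?_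
    rw [← hterm]
    rw [Finset.mem_range] at hj
    rcases hM with rfl | rfl
    · rw [Nat.choose_eq_zero_of_lt (by omega), zero_nsmul]
    · rw [hzero j (by omega), nsmul_zero]
  rw [h1 (max (n + 1) k) (le_max_left _ _) (le_max_right _ _) (n + 1) (Or.inl rfl),
    h1 (max (n + 1) k) (le_max_left _ _) (le_max_right _ _) k (Or.inr rfl)]

/-- Fréchet's theorem: a continuous function whose `k`-th differences with equal steps all vanish
is a polynomial.  On the grid `y + ℕ / N` it is a polynomial; refining the grid does not change
this polynomial, as two polynomials that agree at infinitely many points coincide. -/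
theorem exists_polynomial_of_fwdDiff_iter_eq_zero {f : ℝ → ℝ} (hf : Continuous f) (k : ℕ)
    (h0 : ∀ h b, (fwdDiff h)^[k] f b = 0) :
    ∃ q : Polynomial ℝ, ∀ x, f x = q.eval x := by
  have hgrid : ∀ (y : ℝ) (N : ℕ), ∃ Q : Polynomial ℝ, 0 < N → ∀ n : ℕ,
      f (y + n * (1 / N)) = Q.eval (y + n * (1 / N)) := by
    intro y N
    obtain ⟨P, hP⟩ := exists_polynomial_on_progression (h0 (1 / (N : ℝ))) y
    refine ⟨P.comp (Polynomial.C (N : ℝ) * (Polynomial.X - Polynomial.C y)), fun hN n => ?_⟩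
    have : (N : ℝ) ≠ 0 := by positivity
    rw [hP]
    simp only [Polynomial.eval_comp, Polynomial.eval_mul, Polynomial.eval_C, Polynomial.eval_sub,
      Polynomial.eval_X, add_sub_cancel_left]
    congr 1
    field_simp
  choose Q hQ using hgrid
  have hsame : ∀ (y : ℝ) (N : ℕ), 0 < N → Q y N = Q y 1 := by
    intro y N hN
    refine Polynomial.eq_of_infinite_eval_eq _ _ ?_
    refine (Set.infinite_range_of_injective (f := fun m : ℕ => y + (m : ℝ)) ?_).mono ?_
    · intro a b hab
      simpa using hab
    · rintro _ ⟨m, rfl⟩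
      have h1 := hQ y N hN (m * N)
      have h2 := hQ y 1 one_pos m
      have h3 : y + ((m * N : ℕ) : ℝ) * (1 / N) = y + m := by
        have : (N : ℝ) ≠ 0 := by positivity
        push_cast
        field_simp
      rw [h3] at h1
      simp only [Nat.cast_one, div_one, mul_one] at h2
      exact h1.symm.trans h2
  have hright : ∀ y x, y ≤ x → f x = (Q y 1).eval x := by
    intro y x hxy
    have hlim : Filter.Tendsto (fun N : ℕ => y + (⌊(x - y) * N⌋₊ : ℝ) * (1 / N)) Filter.atTop
        (nhds x) := by
      have h1 := (tendsto_nat_floor_mul_div_atTop (R := ℝ) (sub_nonneg.2 hxy)).comp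
        tendsto_natCast_atTop_atTop
      have h2 := h1.const_add y
      rw [add_sub_cancel] at h2
      refine h2.congr fun N => ?_
      simp [div_eq_mul_inv]
    refine tendsto_nhds_unique ((hf.tendsto x).comp hlim)
      (((Q y 1).continuous.tendsto x).comp hlim |>.congr' ?_)
    filter_upwards [Filter.eventually_gt_atTop 0] with N hN
    simp only [Function.comp_apply]
    rw [hQ y N hN, hsame y N hN]
  refine ⟨Q 0 1, fun x => ?_⟩
  rw [hright x x le_rfl]
  congr 1
  refine Polynomial.eq_of_infinite_eval_eq _ _ ((Set.Ici_infinite (max 0 x)).mono fun z hz => ?_)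
  have hz' := max_le_iff.1 (Set.mem_Ici.1 hz)
  exact (hright x z hz'.2).symm.trans (hright 0 z hz'.1)

/-! ### Density of ridge functions -/

/-- The integral of a curve in a closed subspace lies in the subspace. -/
theorem intervalIntegral_mem_of_isClosed {E : Type*} [NormedAddCommGroup E] [NormedSpace ℝ E]
    [CompleteSpace E] {W : Submodule ℝ E} (hW : IsClosed (W : Set E)) {c : ℝ → E}
    (hc : Continuous c) (hm : ∀ s, c s ∈ W) (a b : ℝ) : ∫ s in a..b, c s ∈ W := by
  have : CompleteSpace W := hW.completeSpace_coe
  have hc' : Continuous fun s => (⟨c s, hm s⟩ : W) := hc.subtype_mk hm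
  have h := W.subtypeL.intervalIntegral_comp_comm
    (hc'.intervalIntegrable (μ := MeasureTheory.volume) a b)
  simp only [Submodule.subtypeL_apply] at h
  rw [h]
  exact Subtype.property _

/-- The derivative of a curve in a closed subspace lies in the subspace. -/
theorem hasDerivAt_mem_of_isClosed {E : Type*} [NormedAddCommGroup E] [NormedSpace ℝ E]
    {W : Submodule ℝ E} (hW : IsClosed (W : Set E)) {c : ℝ → E} {c' : E} {a : ℝ}
    (hc : HasDerivAt c c' a) (hm : ∀ s, c s ∈ W) : c' ∈ W := by
  refine hW.mem_of_tendsto hc.tendsto_slope (Filter.Eventually.of_forall fun s => ?_)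
  exact W.smul_mem _ (W.sub_mem (hm _) (hm _))

section Ridge

variable {X : Type*} [TopologicalSpace X]

/-- The function `x ↦ φ (a u(x) + b)` on `X`. -/
def ridge (u : C(X, ℝ)) (φ : C(ℝ, ℝ)) (a b : ℝ) : C(X, ℝ) :=
  ⟨fun x => φ (a * u x + b), by fun_prop⟩

@[simp] theorem ridge_apply (u : C(X, ℝ)) (φ : C(ℝ, ℝ)) (a b : ℝ) (x : X) :
    ridge u φ a b x = φ (a * u x + b) := rfl

theorem continuous_ridge (u : C(X, ℝ)) (φ : C(ℝ, ℝ)) {α : Type*} [TopologicalSpace α]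
    {a b : α → ℝ} (ha : Continuous a) (hb : Continuous b) :
    Continuous fun s => ridge u φ (a s) (b s) := by
  refine ContinuousMap.continuous_of_continuous_uncurry _ ?_
  simp only [Function.uncurry_def, ridge_apply]
  fun_prop

variable [CompactSpace X]

theorem intervalIntegral_continuousMap_apply {c : ℝ → C(X, ℝ)} (hc : Continuous c) (a b : ℝ)
    (x : X) : (∫ s in a..b, c s) x = ∫ s in a..b, c s x := by
  have h := (ContinuousMap.evalCLM ℝ x).intervalIntegral_comp_comm
    (hc.intervalIntegrable (μ := MeasureTheory.volume) a b)
  simpa using h.symm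

/-- The moving average (up to normalization) `x ↦ ∫₀ʰ φ (x + s) ds`. -/
noncomputable def movingAverage (φ : C(ℝ, ℝ)) (h : ℝ) : C(ℝ, ℝ) :=
  ⟨fun x => ∫ s in (0 : ℝ)..h, φ (x + s), by
    refine intervalIntegral.continuous_parametric_intervalIntegral_of_continuous' ?_ _ _
    simp only [Function.uncurry_def]
    fun_prop⟩

theorem movingAverage_apply (φ : C(ℝ, ℝ)) (h x : ℝ) :
    movingAverage φ h x = ∫ s in (0 : ℝ)..h, φ (x + s) := rfl

theorem hasDerivAt_movingAverage (φ : C(ℝ, ℝ)) (h x : ℝ) :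
    HasDerivAt (movingAverage φ h) (fwdDiff h φ x) x := by
  have hint : ∀ a b, IntervalIntegrable φ MeasureTheory.volume a b :=
    fun a b => φ.continuous.intervalIntegrable a b
  have heq : ∀ y, movingAverage φ h y =
      (∫ s in (0 : ℝ)..(y + h), φ s) - ∫ s in (0 : ℝ)..y, φ s := by
    intro y
    rw [movingAverage_apply, intervalIntegral.integral_interval_sub_left (hint _ _) (hint _ _),
      intervalIntegral.integral_comp_add_left (fun s => φ s) y, add_zero]
  have hprim : ∀ y, HasDerivAt (fun z => ∫ s in (0 : ℝ)..z, φ s) (φ y) y := fun y =>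
    intervalIntegral.integral_hasDerivAt_right (hint _ _)
      (φ.continuous.stronglyMeasurableAtFilter _ _) φ.continuous.continuousAt
  rw [show (movingAverage φ h : ℝ → ℝ) = _ from funext heq]
  exact ((hprim (x + h)).comp_add_const x h).sub (hprim x)

/-- The step that raises the power of `u`: averaging makes `φ` differentiable, and the derivative of
`u ^ k * ψ (a u + b)` in the dilation parameter `a` is `u ^ (k + 1) * ψ' (a u + b)`. -/
theorem pow_mul_ridge_fwdDiff_mem {W : Submodule ℝ C(X, ℝ)} (hW : IsClosed (W : Set C(X, ℝ)))
    (u : C(X, ℝ)) {k : ℕ} {φ φ' : C(ℝ, ℝ)} (hφ : ∀ a b, u ^ k * ridge u φ a b ∈ W) {h : ℝ}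
    (hφ' : ∀ x, φ' x = fwdDiff h φ x) (a b : ℝ) : u ^ (k + 1) * ridge u φ' a b ∈ W := by
  have havg : ∀ a, u ^ k * ridge u (movingAverage φ h) a b ∈ W := by
    intro a
    have hc : Continuous fun s : ℝ => u ^ k * ridge u φ a (b + s) :=
      continuous_const.mul (continuous_ridge u φ continuous_const (by fun_prop))
    convert intervalIntegral_mem_of_isClosed hW hc (fun s => hφ a (b + s)) 0 h using 1
    ext x
    rw [intervalIntegral_continuousMap_apply hc]
    simp [movingAverage_apply, add_assoc, intervalIntegral.integral_const_mul]
  have hc : Continuous fun a : ℝ => u ^ (k + 1) * ridge u φ' a b :=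
    continuous_const.mul (continuous_ridge u φ' (by fun_prop) continuous_const)
  have hprim : ∀ a, u ^ k * ridge u (movingAverage φ h) a b =
      u ^ k * ridge u (movingAverage φ h) 0 b +
        ∫ s in (0 : ℝ)..a, u ^ (k + 1) * ridge u φ' s b := by
    intro a
    ext x
    rw [ContinuousMap.add_apply, intervalIntegral_continuousMap_apply hc, ← sub_eq_iff_eq_add']
    refine (intervalIntegral.integral_eq_sub_of_hasDerivAt
      (f := fun s => (u ^ k * ridge u (movingAverage φ h) s b) x) (fun s _ => ?_)
      (Continuous.intervalIntegrable ?_ _ _)).symm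
    · have h1 : HasDerivAt (fun s => s * u x + b) (u x) s := by
        simpa using ((hasDerivAt_id s).mul_const (u x)).add_const b
      have h2 := ((hasDerivAt_movingAverage φ h (s * u x + b)).comp s h1).const_mul (u x ^ k)
      refine h2.congr_deriv ?_
      simp only [ContinuousMap.mul_apply, ContinuousMap.pow_apply, ridge_apply, hφ']
      ring
    · simp only [ContinuousMap.mul_apply, ContinuousMap.pow_apply, ridge_apply]
      fun_prop
  refine hasDerivAt_mem_of_isClosed hW (c := fun a => u ^ k * ridge u (movingAverage φ h) a b)
    (a := a) ?_ havg
  rw [show (fun a => u ^ k * ridge u (movingAverage φ h) a b) = _ from funext hprim]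
  exact (intervalIntegral.integral_hasDerivAt_right (hc.intervalIntegrable _ _)
    (hc.stronglyMeasurableAtFilter _ _) hc.continuousAt).const_add _

theorem pow_mul_ridge_iterate_fwdDiff_mem {W : Submodule ℝ C(X, ℝ)}
    (hW : IsClosed (W : Set C(X, ℝ))) (u : C(X, ℝ)) {φ : C(ℝ, ℝ)}
    (hφ : ∀ a b, ridge u φ a b ∈ W) (h : ℝ) (k : ℕ) :
    ∃ ψ : C(ℝ, ℝ), (∀ x, ψ x = (fwdDiff h)^[k] φ x) ∧ ∀ a b, u ^ k * ridge u ψ a b ∈ W := by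
  induction k with
  | zero => exact ⟨φ, fun _ => rfl, fun a b => by simpa using hφ a b⟩
  | succ k ih =>
    obtain ⟨ψ, hψ, hmem⟩ := ih
    refine ⟨⟨fwdDiff h ψ, by unfold fwdDiff; fun_prop⟩, fun x => ?_,
      pow_mul_ridge_fwdDiff_mem hW u hmem fun _ => rfl⟩
    rw [Function.iterate_succ_apply', ContinuousMap.coe_mk,
      show (ψ : ℝ → ℝ) = (fwdDiff h)^[k] φ from funext hψ]

/-- For a non-polynomial `φ` some `k`-th difference is nonzero at some `b`; dilation by `a = 0` then
exhibits `u ^ k` up to a nonzero factor. -/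
theorem pow_mem_of_ridge_mem {W : Submodule ℝ C(X, ℝ)} (hW : IsClosed (W : Set C(X, ℝ)))
    (u : C(X, ℝ)) {φ : C(ℝ, ℝ)} (hpoly : ¬ ∃ q : Polynomial ℝ, ∀ x, φ x = q.eval x)
    (hφ : ∀ a b, ridge u φ a b ∈ W) (k : ℕ) : u ^ k ∈ W := by
  obtain ⟨h, b, hb⟩ : ∃ h b, (fwdDiff h)^[k] φ b ≠ 0 := by
    by_contra! hzero
    exact hpoly (exists_polynomial_of_fwdDiff_iter_eq_zero φ.continuous k hzero)
  obtain ⟨ψ, hψ, hmem⟩ := pow_mul_ridge_iterate_fwdDiff_mem hW u hφ h k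
  convert W.smul_mem (ψ b)⁻¹ (hmem 0 b) using 1
  ext x
  have : ψ b ≠ 0 := by rwa [hψ]
  simp
  field_simp

theorem exp_mem_of_ridge_mem {W : Submodule ℝ C(X, ℝ)} (hW : IsClosed (W : Set C(X, ℝ)))
    (u : C(X, ℝ)) {φ : C(ℝ, ℝ)} (hpoly : ¬ ∃ q : Polynomial ℝ, ∀ x, φ x = q.eval x)
    (hφ : ∀ a b, ridge u φ a b ∈ W) : NormedSpace.exp u ∈ W := by
  refine hW.mem_of_tendsto (NormedSpace.exp_series_hasSum_exp' (𝕂 := ℝ) u)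
    (Filter.Eventually.of_forall fun s => ?_)
  exact W.sum_mem fun n _ => W.smul_mem _ (pow_mem_of_ridge_mem hW u hpoly hφ n)

end Ridge

/-- The linear form `x ↦ ∑ i, w i * x i` on a set of vectors. -/
def linearForm {ι : Type*} [Fintype ι] (X : Set (EuclideanSpace ℝ ι)) (w : ι → ℝ) : C(X, ℝ) :=
  ⟨fun x => w ⬝ᵥ (x : EuclideanSpace ℝ ι).ofLp, by unfold dotProduct; fun_prop⟩

/-- Density of single-layer networks (Leshno, Lin, Pinkus, Schocken).  The closed span contains the
exponentials of linear forms, which span an algebra that separates points. -/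
theorem topologicalClosure_span_ridge_eq_top {ι : Type*} [Fintype ι]
    (X : Set (EuclideanSpace ℝ ι)) [CompactSpace X] (φ : C(ℝ, ℝ))
    (hpoly : ¬ ∃ q : Polynomial ℝ, ∀ x, φ x = q.eval x) :
    (Submodule.span ℝ (Set.range fun wb : (ι → ℝ) × ℝ =>
      ridge (linearForm X wb.1) φ 1 wb.2)).topologicalClosure = ⊤ := by
  set W := (Submodule.span ℝ (Set.range fun wb : (ι → ℝ) × ℝ =>
      ridge (linearForm X wb.1) φ 1 wb.2)).topologicalClosure with hWdef
  have hW : IsClosed (W : Set C(X, ℝ)) := Submodule.isClosed_topologicalClosure _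
  have hexp : ∀ w, NormedSpace.exp (linearForm X w) ∈ W := by
    intro w
    refine exp_mem_of_ridge_mem hW _ hpoly fun a b => ?_
    refine Submodule.le_topologicalClosure _ (Submodule.subset_span ⟨(a • w, b), ?_⟩)
    ext x
    simp [linearForm]
  have hexp_apply : ∀ (v : C(X, ℝ)) x, NormedSpace.exp v x = Real.exp (v x) := by
    intro v x
    have := NormedSpace.map_exp_of_mem_ball (𝕂 := ℝ) (ContinuousMap.evalAlgHom ℝ ℝ x)
      (continuous_eval_const x) v
      ((NormedSpace.expSeries_radius_eq_top ℝ C(X, ℝ)).symm ▸ edist_lt_top _ _)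
    rw [Real.exp_eq_exp_ℝ]
    simpa using this
  let E : Multiplicative (ι → ℝ) →* C(X, ℝ) :=
    { toFun := fun w => NormedSpace.exp (linearForm X w.toAdd)
      map_one' := by ext x; simp [hexp_apply, linearForm]
      map_mul' := fun v w => by ext x; simp [hexp_apply, linearForm, Real.exp_add] }
  have hsub : ((Algebra.adjoin ℝ (MonoidHom.mrange E : Set C(X, ℝ))).toSubmodule) ≤ W := by
    rw [Algebra.adjoin_eq_span, Submonoid.closure_eq, Submodule.span_le]
    rintro _ ⟨w, rfl⟩
    exact hexp _
  have hsep : (Algebra.adjoin ℝ (MonoidHom.mrange E : Set C(X, ℝ))).SeparatesPoints := by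
    intro x y hxy
    obtain ⟨i, hi⟩ : ∃ i, (x : EuclideanSpace ℝ ι) i ≠ (y : EuclideanSpace ℝ ι) i := by
      by_contra! hall
      exact hxy (Subtype.ext (PiLp.ext hall))
    classical
    refine ⟨_, ⟨_, Algebra.subset_adjoin ⟨Multiplicative.ofAdd (Pi.single i 1), rfl⟩, rfl⟩, ?_⟩
    simpa [E, hexp_apply, linearForm] using hi
  have htop := ContinuousMap.subalgebra_topologicalClosure_eq_top_of_separatesPoints _ hsep
  rw [eq_top_iff]
  intro v _
  have hv : v ∈ (Algebra.adjoin ℝ (MonoidHom.mrange E : Set C(X, ℝ))).topologicalClosure := by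
    rw [htop]; trivial
  exact closure_minimal hsub hW hv

/-- Universal approximation of continuous maps on a compact set. -/
theorem approximableByTwoLayerNets_of_continuous {ι : Type*} [Fintype ι]
    {X : Set (EuclideanSpace ℝ ι)} (hX : IsCompact X) {L : X → EuclideanSpace ℝ ι}
    (hL : Continuous L) : ApproximableByTwoLayerNets L := by
  intro σ hσ hpoly ε hε
  have : CompactSpace X := isCompact_iff_compactSpace.1 hX
  classical
  have hd : 0 < ε / (Fintype.card ι + 1) := by positivity
  set δ := ε / (Fintype.card ι + 1) with hδ
  have happ : ∀ i, ∃ c : ((ι → ℝ) × ℝ) →₀ ℝ, ∀ x : X,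
      |L x i - c.sum fun wb r => r * σ (wb.1 ⬝ᵥ (x : EuclideanSpace ℝ ι).ofLp + wb.2)| < δ := by
    intro i
    let v : C(X, ℝ) := ⟨fun x => L x i, by fun_prop⟩
    have hv : v ∈ (Submodule.span ℝ (Set.range fun wb : (ι → ℝ) × ℝ =>
        ridge (linearForm X wb.1) ⟨σ, hσ⟩ 1 wb.2)).topologicalClosure := by
      rw [topologicalClosure_span_ridge_eq_top X ⟨σ, hσ⟩ hpoly]; trivial
    obtain ⟨w, hw, hdist⟩ := Metric.mem_closure_iff.1 hv δ hd
    obtain ⟨c, rfl⟩ := Finsupp.mem_span_range_iff_exists_finsupp.1 hw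
    refine ⟨c, fun x => ?_⟩
    have h1 := (ContinuousMap.dist_apply_le_dist x).trans_lt hdist
    rw [Real.dist_eq] at h1
    have h2 : (c.sum fun wb r => r • ridge (linearForm X wb.1) ⟨σ, hσ⟩ 1 wb.2) x =
        c.sum fun wb r => r * σ (wb.1 ⬝ᵥ (x : EuclideanSpace ℝ ι).ofLp + wb.2) := by
      simp [Finsupp.sum, ContinuousMap.sum_apply, linearForm]
    rwa [h2] at h1
  choose c hc using happ
  -- a neuron with weight zero makes the hidden layer nonempty
  let s : Finset ((ι → ℝ) × ℝ) := insert 0 (Finset.univ.biUnion fun i => (c i).support)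
  have hs : ∀ i, (c i).support ⊆ s := fun i =>
    (Finset.subset_biUnion_of_mem (fun i => (c i).support) (Finset.mem_univ i)).trans
      (Finset.subset_insert _ _)
  let e := s.equivFin
  refine ⟨s.card, Matrix.of fun m => (e.symm m : (ι → ℝ) × ℝ).1, fun m => (e.symm m).1.2,
    Matrix.of fun i m => c i (e.symm m), Finset.card_pos.2 ⟨0, Finset.mem_insert_self _ _⟩, ?_⟩
  have hnet : ∀ (x : X) (i : ι), twoLayerNet σ (Matrix.of fun m => (e.symm m : (ι → ℝ) × ℝ).1)
      (fun m => (e.symm m).1.2) (Matrix.of fun i m => c i (e.symm m)) x i =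
      (c i).sum fun wb r => r * σ (wb.1 ⬝ᵥ (x : EuclideanSpace ℝ ι).ofLp + wb.2) := by
    intro x i
    rw [Finsupp.sum_of_support_subset _ (hs i) _ (by simp), ← Finset.sum_coe_sort s,
      ← e.symm.sum_comp]
    simp [twoLayerNet, Matrix.mulVec, dotProduct]
  have hbound : ∀ x : X, ‖L x - twoLayerNet σ (Matrix.of fun m => (e.symm m : (ι → ℝ) × ℝ).1)
      (fun m => (e.symm m).1.2) (Matrix.of fun i m => c i (e.symm m)) x‖ ≤
      Fintype.card ι * δ := by
    intro x
    set y := L x - twoLayerNet σ (Matrix.of fun m => (e.symm m : (ι → ℝ) × ℝ).1)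
      (fun m => (e.symm m).1.2) (Matrix.of fun i m => c i (e.symm m)) x with hy
    have h1 : ∀ i, |y i| ≤ δ := fun i => by
      rw [hy, PiLp.sub_apply, hnet]
      exact (hc i x).le
    calc ‖y‖ = ‖∑ i, EuclideanSpace.single i (y i)‖ := by
          congr 1
          ext j
          simp [Pi.single_apply]
      _ ≤ ∑ i, ‖EuclideanSpace.single i (y i)‖ := norm_sum_le _ _
      _ ≤ ∑ _i : ι, δ := Finset.sum_le_sum fun i _ => by simpa using h1 i
      _ = Fintype.card ι * δ := by simp
  refine (iSup_le fun x => ENNReal.ofReal_le_ofReal (hbound x)).trans_lt ?_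
  rw [ENNReal.ofReal_lt_ofReal_iff hε, hδ, mul_div_assoc', div_lt_iff₀ (by positivity)]
  nlinarith

/-- The twist operator factors through the inverse of an injective continuous map on a compact
parameter set, which is continuous. -/
theorem approximable_twistOperator {g : Polynomial ℝ} {hop : ℝ → ℝ → ℝ → ℝ} {Nd NE : ℕ}
    {Emin Emax : ℝ} {P : Set Params} (hP : IsCompact P)
    (hK : Function.Injective (untwistedMap g hop Nd NE Emin Emax P))
    (hcont : ∀ θ, 0 ≤ θ → θ < 1 → Continuous fun p : P => ldosImage g hop Nd NE Emin Emax θ p)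
    {θ : ℝ} (h0 : 0 ≤ θ) (h1 : θ < 1) :
    ApproximableByTwoLayerNets (twistOperator g hop Nd NE Emin Emax θ P hK) := by
  have : CompactSpace P := isCompact_iff_compactSpace.1 hP
  have hKc : Continuous (untwistedMap g hop Nd NE Emin Emax P) := hcont 0 le_rfl one_pos
  refine approximableByTwoLayerNets_of_continuous (isCompact_range hKc) ?_
  have hinv : Continuous (Equiv.ofInjective _ hK).symm :=
    Continuous.continuous_symm_of_equiv_compact_to_t2 (f := Equiv.ofInjective _ hK)
      (hKc.subtype_mk _)
  exact (hcont θ h0 h1).comp hinv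

/-! ### Continuity in the model parameters -/

/-- Schur test, as a bound on the operator norm. -/
theorem norm_le_of_actsBy {M : Site → Site → ℝ} {T : WaveSpace →L[ℂ] WaveSpace}
    (hT : ActsBy M T) {C : ℝ} (hrow : ∀ i (s : Finset Site), ∑ j ∈ s, |M i j| ≤ C)
    (hcol : ∀ j (s : Finset Site), ∑ i ∈ s, |M i j| ≤ C) : ‖T‖ ≤ C := by
  have hC : 0 ≤ C := by simpa using hrow (Sum.inl 0) ∅
  have hfin : ∀ (ψ : WaveSpace) (s F : Finset Site),
      ∑ i ∈ s, ‖∑ j ∈ F, (M i j : ℂ) * ψ j‖ ^ 2 ≤ (C * ‖ψ‖) ^ 2 := by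
    intro ψ s F
    have h1 : ∀ i, ‖∑ j ∈ F, (M i j : ℂ) * ψ j‖ ^ 2 ≤ C * ∑ j ∈ F, |M i j| * ‖ψ j‖ ^ 2 := by
      intro i
      have h2 : ‖∑ j ∈ F, (M i j : ℂ) * ψ j‖ ≤ ∑ j ∈ F, |M i j| * ‖ψ j‖ := by
        refine (norm_sum_le _ _).trans (le_of_eq (Finset.sum_congr rfl fun j _ => ?_))
        rw [norm_mul, Complex.norm_real, Real.norm_eq_abs]
      have h3 : (∑ j ∈ F, |M i j| * ‖ψ j‖) ^ 2 ≤
          (∑ j ∈ F, |M i j|) * ∑ j ∈ F, |M i j| * ‖ψ j‖ ^ 2 :=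
        Finset.sum_sq_le_sum_mul_sum_of_sq_le_mul F (fun _ _ => abs_nonneg _)
          (fun _ _ => by positivity) (fun j _ => le_of_eq (by ring))
      calc ‖∑ j ∈ F, (M i j : ℂ) * ψ j‖ ^ 2 ≤ (∑ j ∈ F, |M i j| * ‖ψ j‖) ^ 2 := by gcongr
        _ ≤ _ := h3
        _ ≤ _ := mul_le_mul_of_nonneg_right (hrow i F)
          (Finset.sum_nonneg fun _ _ => by positivity)
    have h4 : ∑ j ∈ F, ‖ψ j‖ ^ 2 ≤ ‖ψ‖ ^ 2 := by
      simpa using lp.sum_rpow_le_norm_rpow (p := 2) (by norm_num) ψ F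
    calc ∑ i ∈ s, ‖∑ j ∈ F, (M i j : ℂ) * ψ j‖ ^ 2
        ≤ ∑ i ∈ s, C * ∑ j ∈ F, |M i j| * ‖ψ j‖ ^ 2 := Finset.sum_le_sum fun i _ => h1 i
      _ = C * ∑ j ∈ F, (∑ i ∈ s, |M i j|) * ‖ψ j‖ ^ 2 := by
          rw [← Finset.mul_sum, Finset.sum_comm]
          simp_rw [Finset.sum_mul]
      _ ≤ C * ∑ j ∈ F, C * ‖ψ j‖ ^ 2 := by
          gcongr with j _
          exact hcol j s
      _ = C * C * ∑ j ∈ F, ‖ψ j‖ ^ 2 := by rw [← Finset.mul_sum, mul_assoc]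
      _ ≤ C * C * ‖ψ‖ ^ 2 := by gcongr
      _ = (C * ‖ψ‖) ^ 2 := by ring
  refine T.opNorm_le_bound hC fun ψ => ?_
  refine lp.norm_le_of_forall_sum_le (p := 2) (by norm_num) (by positivity) fun s => ?_
  simp only [ENNReal.toReal_ofNat, Real.rpow_ofNat]
  exact le_of_tendsto (tendsto_finsetSum s fun i _ => ((hT ψ i).norm.pow 2))
    (Filter.Eventually.of_forall fun F => hfin ψ s F)

theorem sum_abs_intralayer_le (ε t : ℝ) (m : ℤ) (s : Finset ℤ) :
    ∑ n ∈ s, |intralayer ε t (m - n)| ≤ 2 * |t| + |ε| := by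
  have hb : ∀ n : ℤ, |intralayer ε t (m - n)| ≤
      (if m - 1 = n then |t| else 0) + (if m + 1 = n then |t| else 0) +
        (if m = n then |ε| else 0) := by
    intro n
    unfold intralayer
    have := abs_nonneg t
    have := abs_nonneg ε
    split_ifs <;> first | omega | simp
  refine (Finset.sum_le_sum fun n _ => hb n).trans ?_
  rw [Finset.sum_add_distrib, Finset.sum_add_distrib, two_mul]
  simp only [Finset.sum_ite_eq]
  have := abs_nonneg t
  have := abs_nonneg ε
  gcongr <;> split_ifs <;> simp

/-- Row sums of the hopping matrix, with a constant that does not depend on the size of the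
hopping energies. -/
theorem exists_sum_abs_hopping_le {θ γ : ℝ} (hθ : θ < 1) (hγ : 0 < γ) :
    ∃ C, ∀ (d ε t h₀ : ℝ) (h : ℝ → ℝ), (∀ x, |h (|x|)| ≤ h₀ * Real.exp (-γ * |x|)) →
      ∀ i (s : Finset Site), ∑ j ∈ s, |hopping θ d ε t h i j| ≤ 2 * |t| + |ε| + h₀ * C := by
  obtain ⟨C₁, hC₁⟩ := exists_lattice_sum_bound hγ one_pos
  obtain ⟨C₂, hC₂⟩ := exists_lattice_sum_bound hγ (by linarith : 0 < 1 - θ)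
  refine ⟨C₁ + C₂, fun d ε t h₀ h hh i s => ?_⟩
  have hh0 : 0 ≤ h₀ := by simpa using (abs_nonneg _).trans (hh 0)
  have hA : ∀ (x : ℝ) (s : Finset ℤ), ∑ n ∈ s, |h (|x - n * (1 - θ)|)| ≤ h₀ * C₂ := by
    intro x s
    calc _ ≤ ∑ n ∈ s, h₀ * Real.exp (-γ * |x - n * (1 - θ)|) :=
          Finset.sum_le_sum fun n _ => hh (x - n * (1 - θ))
      _ ≤ _ := by rw [← Finset.mul_sum]; gcongr; exact hC₂ x s
  have hB : ∀ (x : ℝ) (s : Finset ℤ), ∑ n ∈ s, |h (|x - n|)| ≤ h₀ * C₁ := by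
    intro x s
    calc _ ≤ ∑ n ∈ s, h₀ * Real.exp (-γ * |x - n * 1|) :=
          Finset.sum_le_sum fun n _ => by simpa using hh (x - n)
      _ ≤ _ := by rw [← Finset.mul_sum]; gcongr; exact hC₁ x s
  have p1 : 0 ≤ h₀ * C₁ := by simpa using hB 0 ∅
  have p2 : 0 ≤ h₀ * C₂ := by simpa using hA 0 ∅
  rw [← Finset.toLeft_disjSum_toRight (u := s), Finset.sum_disjSum]
  rcases i with m | m <;> simp only [hopping]
  · have := sum_abs_intralayer_le ε t m s.toLeft
    have := hA (m - d) s.toRight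
    linarith
  · have := sum_abs_intralayer_le ε t m s.toRight
    have := hB (m * (1 - θ) + d) s.toLeft
    linarith

theorem intralayer_sub (ε t ε' t' : ℝ) (k : ℤ) :
    intralayer (ε - ε') (t - t') k = intralayer ε t k - intralayer ε' t' k := by
  unfold intralayer
  split_ifs <;> simp

theorem hopping_sub (θ d ε t ε' t' : ℝ) (h h' : ℝ → ℝ) (R R' : Site) :
    hopping θ d (ε - ε') (t - t') (h - h') R R' =
      hopping θ d ε t h R R' - hopping θ d ε' t' h' R R' := by
  rcases R with m | m <;> rcases R' with n | n <;> simp [hopping, intralayer_sub]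

theorem actsBy_sub {M M' : Site → Site → ℝ} {T T' : WaveSpace →L[ℂ] WaveSpace}
    (hT : ActsBy M T) (hT' : ActsBy M' T') : ActsBy (fun R R' => M R R' - M' R R') (T - T') := by
  intro ψ R
  have h := (hT ψ R).sub (hT' ψ R)
  simp only [← sub_mul, ← Complex.ofReal_sub] at h
  exact h

theorem actsBy_hamiltonian_expHop {θ : ℝ} (hθ : θ < 1) (d ε t : ℝ) {ν l : ℝ} (hν : 0 < ν)
    (hl : 0 < l) :
    ActsBy (hopping θ d ε t (expHop ν l)) (hamiltonian θ d ε t (expHop ν l)) :=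
  actsBy_hamiltonian hθ d ε t (by positivity : 0 < 1 / l) (expHop_decay hν)

/-- Exponentials with rates at least `2 γ` differ by a multiple of the exponential with rate `γ`. -/
theorem abs_exp_sub_exp_le {a b γ x : ℝ} (hγ : 0 < γ) (ha : 2 * γ ≤ a) (hb : 2 * γ ≤ b)
    (hx : 0 ≤ x) :
    |Real.exp (-(a * x)) - Real.exp (-(b * x))| ≤ |a - b| / γ * Real.exp (-γ * x) := by
  wlog hab : a ≤ b generalizing a b
  · rw [abs_sub_comm, abs_sub_comm a b]
    exact this hb ha (le_of_not_ge hab)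
  have h1 : Real.exp (-(b * x)) ≤ Real.exp (-(a * x)) :=
    Real.exp_le_exp.2 (by nlinarith)
  rw [abs_of_nonneg (sub_nonneg.2 h1), abs_of_nonpos (sub_nonpos.2 hab)]
  have h2 : Real.exp (-(a * x)) - Real.exp (-(b * x)) ≤ (b - a) * x * Real.exp (-(a * x)) := by
    have h3 : Real.exp (-(b * x)) = Real.exp (-((b - a) * x)) * Real.exp (-(a * x)) := by
      rw [← Real.exp_add]; congr 1; ring
    have h4 := Real.add_one_le_exp (-((b - a) * x))
    have h5 := Real.exp_pos (-(a * x))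
    rw [h3]
    nlinarith
  have h6 : x * Real.exp (-(a * x)) ≤ 1 / γ * Real.exp (-γ * x) := by
    have h7 : γ * x ≤ Real.exp (γ * x) := by linarith [Real.add_one_le_exp (γ * x)]
    have h8 : Real.exp (-(a * x)) ≤ Real.exp (-γ * x) * Real.exp (-(γ * x)) := by
      rw [← Real.exp_add]
      exact Real.exp_le_exp.2 (by nlinarith)
    have h9 : γ * x * Real.exp (-(γ * x)) ≤ 1 := by
      rw [Real.exp_neg, ← div_eq_mul_inv]
      exact (div_le_one (Real.exp_pos _)).2 h7
    have h10 := Real.exp_pos (-γ * x)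
    rw [div_mul_eq_mul_div, le_div_iff₀ hγ]
    calc x * Real.exp (-(a * x)) * γ
        ≤ x * (Real.exp (-γ * x) * Real.exp (-(γ * x))) * γ := by gcongr
      _ = (γ * x * Real.exp (-(γ * x))) * Real.exp (-γ * x) := by ring
      _ ≤ 1 * Real.exp (-γ * x) := by gcongr
  calc _ ≤ (b - a) * (x * Real.exp (-(a * x))) := by linarith
    _ ≤ (b - a) * (1 / γ * Real.exp (-γ * x)) :=
      mul_le_mul_of_nonneg_left h6 (sub_nonneg.2 hab)
    _ = _ := by ring

/-- The Hamiltonian is continuous in the parameters in the operator norm. -/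
theorem continuousAt_hamiltonian_expHop {θ : ℝ} (hθ : θ < 1) (d : ℝ) {p₀ : Params}
    (hν : 0 < p₀.2.2.1) (hl : 0 < p₀.2.2.2) :
    ContinuousAt (fun p : Params => hamiltonian θ d p.1 p.2.1 (expHop p.2.2.1 p.2.2.2)) p₀ := by
  obtain ⟨ε₀, t₀, ν₀, l₀⟩ := p₀
  simp only at hν hl
  -- for `l < 2 l₀` all hopping functions decay at least with rate `2 γ = 1 / (2 l₀)`
  set γ : ℝ := 1 / (4 * l₀) with hγdef
  have hγ : 0 < γ := by positivity
  obtain ⟨C, hC⟩ := exists_sum_abs_hopping_le hθ hγ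
  set B : Params → ℝ := fun p => 2 * |p.2.1 - t₀| + |p.1 - ε₀| +
    (|p.2.2.1 - ν₀| + ν₀ * (|1 / p.2.2.2 - 1 / l₀| / γ)) * C with hB
  have hB0 : Filter.Tendsto B (nhds (ε₀, t₀, ν₀, l₀)) (nhds 0) := by
    have h1 : ContinuousAt B (ε₀, t₀, ν₀, l₀) := by
      have h2 : ContinuousAt (fun p : Params => 1 / p.2.2.2) (ε₀, t₀, ν₀, l₀) :=
        continuousAt_const.div (by fun_prop) hl.ne'
      simp only [hB]
      fun_prop
    simpa [ContinuousAt, hB] using h1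
  rw [ContinuousAt, tendsto_iff_norm_sub_tendsto_zero]
  refine squeeze_zero' (Filter.Eventually.of_forall fun _ => norm_nonneg _) ?_ hB0
  have hpos : ∀ᶠ p : Params in nhds (ε₀, t₀, ν₀, l₀),
      0 < p.2.2.1 ∧ 0 < p.2.2.2 ∧ p.2.2.2 < 2 * l₀ := by
    have c3 : Continuous fun p : Params => p.2.2.1 := by fun_prop
    have c4 : Continuous fun p : Params => p.2.2.2 := by fun_prop
    filter_upwards [c3.continuousAt.eventually (lt_mem_nhds hν),
      c4.continuousAt.eventually (lt_mem_nhds hl),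
      c4.continuousAt.eventually (gt_mem_nhds (by linarith : l₀ < 2 * l₀))]
      with p h1 h2 h3 using ⟨h1, h2, h3⟩
  filter_upwards [hpos] with p ⟨hpν, hpl, hpl2⟩
  have hdecay : ∀ x, |(expHop p.2.2.1 p.2.2.2 - expHop ν₀ l₀) (|x|)| ≤
      (|p.2.2.1 - ν₀| + ν₀ * (|1 / p.2.2.2 - 1 / l₀| / γ)) * Real.exp (-γ * |x|) := by
    intro x
    have ha : 2 * γ ≤ 1 / p.2.2.2 := by
      rw [hγdef, le_div_iff₀ hpl]
      field_simp
      linarith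
    have hb : 2 * γ ≤ 1 / l₀ := by
      rw [hγdef]
      field_simp
      norm_num
    have h1 := abs_exp_sub_exp_le hγ ha hb (abs_nonneg x)
    have h2 : Real.exp (-(1 / p.2.2.2 * |x|)) ≤ Real.exp (-γ * |x|) :=
      Real.exp_le_exp.2 (by nlinarith [abs_nonneg x])
    have h3 : (expHop p.2.2.1 p.2.2.2 - expHop ν₀ l₀) (|x|) =
        (p.2.2.1 - ν₀) * Real.exp (-(1 / p.2.2.2 * |x|)) +
          ν₀ * (Real.exp (-(1 / p.2.2.2 * |x|)) - Real.exp (-(1 / l₀ * |x|))) := by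
      simp only [Pi.sub_apply, expHop, abs_abs, neg_div]
      rw [div_eq_inv_mul, div_eq_inv_mul, one_div, one_div]
      ring
    rw [h3]
    refine (abs_add_le _ _).trans ?_
    rw [abs_mul, abs_mul, abs_of_pos hν, abs_of_pos (Real.exp_pos _), add_mul, mul_assoc ν₀]
    gcongr
  have hact := actsBy_sub (actsBy_hamiltonian_expHop hθ d p.1 p.2.1 hpν hpl)
    (actsBy_hamiltonian_expHop hθ d ε₀ t₀ hν hl)
  simp only [← hopping_sub] at hact
  have hrow := hC d (p.1 - ε₀) (p.2.1 - t₀) _ _ hdecay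
  exact norm_le_of_actsBy hact hrow fun j s => by
    simpa only [hopping_symm _ _ _ _ _ _ j] using hrow j s

theorem ldos_eq_re_entry (g : Polynomial ℝ) {θ : ℝ} (hθ : θ < 1) (ε t : ℝ) (h : ℝ → ℝ) (d E : ℝ) :
    ldos g θ ε t h d E =
      (entry (polyOfShifted g (hamiltonian θ d ε t h) E) (Sum.inr 0) (Sum.inr 0)).re := by
  rw [ldos, homeOrbitals_eq hθ, finsum_mem_singleton]

theorem continuous_entry (R R' : Site) :
    Continuous fun A : WaveSpace →L[ℂ] WaveSpace => entry A R R' := by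
  have h1 : Continuous fun A : WaveSpace →L[ℂ] WaveSpace => A (lp.single 2 R' (1 : ℂ)) := by
    fun_prop
  exact (lp.evalCLM ℂ (fun _ : Site => ℂ) 2 R).continuous.comp h1

theorem continuous_ldosImage_expHop (g : Polynomial ℝ) (Nd NE : ℕ) (Emin Emax : ℝ) {θ : ℝ}
    (hθ : θ < 1) {P : Set Params} (hP : Admissible P) :
    Continuous fun p : P => ldosImage g expHop Nd NE Emin Emax θ p := by
  refine (PiLp.continuous_toLp 2 _).comp (continuous_pi fun ij => ?_)
  simp only [ldos_eq_re_entry g hθ]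
  refine Complex.continuous_re.comp ((continuous_entry _ _).comp ?_)
  refine (Polynomial.continuous_aeval _).comp (Continuous.sub ?_ continuous_const)
  refine continuous_iff_continuousAt.2 fun p => ?_
  exact ContinuousAt.comp (f := ((↑) : P → Params))
    (continuousAt_hamiltonian_expHop hθ _ (hP p p.2).2.1 (hP p p.2).2.2)
    continuous_subtype_val.continuousAt

/-! ### The moments of the local density of states -/

/-- Taylor expansion of `g (H - E)` at `-E`. -/
theorem ldos_eq_sum (g : Polynomial ℝ) {θ : ℝ} (hθ : θ < 1) (ε t : ℝ) (h : ℝ → ℝ) (d E : ℝ) :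
    ldos g θ ε t h d E = ∑ m ∈ Finset.range (g.natDegree + 1),
      (Polynomial.hasseDeriv m g).eval (-E) *
        (entry (hamiltonian θ d ε t h ^ m) (Sum.inr 0) (Sum.inr 0)).re := by
  have h1 : ∀ (H : WaveSpace →L[ℂ] WaveSpace), polyOfShifted g H E =
      ∑ m ∈ Finset.range (g.natDegree + 1),
        (((Polynomial.hasseDeriv m g).eval (-E) : ℝ) : ℂ) • H ^ m := by
    intro H
    have h2 : H - (E : ℂ) • (1 : WaveSpace →L[ℂ] WaveSpace) =
        Polynomial.aeval H (Polynomial.X + Polynomial.C (-E : ℂ)) := by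
      simp [Algebra.algebraMap_eq_smul_one, sub_eq_add_neg]
    have h3 : (-E : ℂ) = algebraMap ℝ ℂ (-E) := by simp
    rw [polyOfShifted, h2, ← Polynomial.aeval_comp, ← Polynomial.taylor_apply,
      Polynomial.aeval_eq_sum_range, Polynomial.natDegree_taylor,
      Polynomial.natDegree_map]
    refine Finset.sum_congr rfl fun m _ => ?_
    rw [h3, ← Polynomial.map_taylor, Polynomial.coeff_map, Polynomial.taylor_coeff]
    rfl
  rw [ldos_eq_re_entry g hθ, h1]
  have h4 : ∀ (s : Finset ℕ) (c : ℕ → ℝ) (A : ℕ → (WaveSpace →L[ℂ] WaveSpace)) (R : Site),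
      (entry (∑ m ∈ s, (c m : ℂ) • A m) R R).re = ∑ m ∈ s, c m * (entry (A m) R R).re := by
    intro s c A R
    let L : (WaveSpace →L[ℂ] WaveSpace) →ₗ[ℂ] ℂ :=
      { toFun := fun A => entry A R R
        map_add' := fun _ _ => rfl
        map_smul' := fun _ _ => rfl }
    change (L (∑ m ∈ s, (c m : ℂ) • A m)).re = ∑ m ∈ s, c m * (L (A m)).re
    simp [map_sum]
  exact h4 _ _ _ _

/-- In a linear combination of the Hasse derivatives of `g` that vanishes at more than `deg g`
points, the coefficients of the first and second derivative vanish if that of `g` does. -/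
theorem coeff_eq_zero_of_sum_hasseDeriv_eval_eq_zero {g : Polynomial ℝ} (hg : 2 ≤ g.natDegree)
    {c : ℕ → ℝ} (hc : c 0 = 0) {ι : Type*} [Fintype ι] (hι : g.natDegree < Fintype.card ι)
    {y : ι → ℝ} (hy : Function.Injective y)
    (h : ∀ j, ∑ m ∈ Finset.range (g.natDegree + 1),
      (Polynomial.hasseDeriv m g).eval (y j) * c m = 0) : c 1 = 0 ∧ c 2 = 0 := by
  set n := g.natDegree with hn
  have hlead : g.coeff n ≠ 0 := by
    rw [hn, Polynomial.coeff_natDegree]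
    intro h0
    rw [Polynomial.leadingCoeff_eq_zero] at h0
    simp [h0] at hn
    omega
  set R : Polynomial ℝ := ∑ m ∈ Finset.range (n + 1),
    Polynomial.C (c m) * Polynomial.hasseDeriv m g with hR
  have hRdeg : R.natDegree ≤ n := by
    refine Polynomial.natDegree_sum_le_of_forall_le _ _ fun m _ => ?_
    refine (Polynomial.natDegree_C_mul_le _ _).trans ?_
    exact (Polynomial.natDegree_hasseDeriv_le g m).trans (Nat.sub_le _ _)
  have hR0 : R = 0 := by
    refine Polynomial.eq_zero_of_natDegree_lt_card_of_eval_eq_zero R hy (fun j => ?_)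
      (hRdeg.trans_lt hι)
    rw [hR, Polynomial.eval_finsetSum, ← h j]
    exact Finset.sum_congr rfl fun m _ => by simp [mul_comm]
  have hcoeff : ∀ i, ∑ m ∈ Finset.range (n + 1),
      c m * (((i + m).choose m : ℝ) * g.coeff (i + m)) = 0 := by
    intro i
    have := congrArg (fun q => Polynomial.coeff q i) hR0
    simpa [hR, Polynomial.finsetSum_coeff, Polynomial.hasseDeriv_coeff] using this
  have hvanish : ∀ i m, n < i + m → c m * (((i + m).choose m : ℝ) * g.coeff (i + m)) = 0 := by
    intro i m him
    rw [Polynomial.coeff_eq_zero_of_natDegree_lt him, mul_zero, mul_zero]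
  have h1 : c 1 = 0 := by
    have h2 := hcoeff (n - 1)
    rw [Finset.sum_eq_single_of_mem 1 (Finset.mem_range.2 (by omega))] at h2
    · rw [Nat.sub_add_cancel (by omega)] at h2
      have : (n : ℝ) ≠ 0 := by norm_cast; omega
      simpa [hlead, this] using h2
    · intro m _ hm
      rcases Nat.lt_or_gt_of_ne hm with hm | hm
      · obtain rfl : m = 0 := by omega
        rw [hc, zero_mul]
      · exact hvanish _ _ (by omega)
  refine ⟨h1, ?_⟩
  have h2 := hcoeff (n - 2)
  rw [Finset.sum_eq_single_of_mem 2 (Finset.mem_range.2 (by omega))] at h2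
  · rw [Nat.sub_add_cancel (by omega)] at h2
    have : (n.choose 2 : ℝ) ≠ 0 := by
      exact_mod_cast (Nat.choose_pos hg).ne'
    simpa [hlead, this] using h2
  · intro m _ hm
    rcases Nat.lt_or_gt_of_ne hm with hm | hm
    · obtain rfl | rfl : m = 0 ∨ m = 1 := by omega
      · rw [hc, zero_mul]
      · rw [h1, zero_mul]
    · exact hvanish _ _ (by omega)

/-- Diagonal entries of the square of a real symmetric operator. -/
theorem hasSum_entry_sq {M : Site → Site → ℝ} {T : WaveSpace →L[ℂ] WaveSpace} (hT : ActsBy M T)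
    (hM : ∀ R R', M R R' = M R' R) (R : Site) :
    HasSum (fun R' => M R R' ^ 2) (entry (T ^ 2) R R).re := by
  have h1 := hT (T (lp.single 2 R (1 : ℂ))) R
  have h2 := Complex.hasSum_re h1
  have h3 : T (T (lp.single 2 R (1 : ℂ))) R = entry (T ^ 2) R R := by
    rw [pow_two]; rfl
  rw [h3] at h2
  refine h2.congr_fun fun R' => ?_
  have h4 : T (lp.single 2 R (1 : ℂ)) R' = M R' R := entry_of_actsBy hT R' R
  rw [h4, hM R' R, ← Complex.ofReal_mul, Complex.ofReal_re, pow_two]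

/-- The second moment at `θ = 0`. -/
theorem hasSum_sq_hop {d ε t : ℝ} {h : ℝ → ℝ} {T : WaveSpace →L[ℂ] WaveSpace}
    (hT : ActsBy (hopping 0 d ε t h) T) :
    HasSum (fun n : ℤ => h |d - n| ^ 2)
      ((entry (T ^ 2) (Sum.inr 0) (Sum.inr 0)).re - (ε ^ 2 + 2 * t ^ 2)) := by
  have h1 := hasSum_entry_sq hT (hopping_symm _ _ _ _ _) (Sum.inr 0)
  have h2 : HasSum ((fun R' => hopping 0 d ε t h (Sum.inr 0) R' ^ 2) ∘ Sum.inr)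
      (ε ^ 2 + 2 * t ^ 2) := by
    have h3 : ∀ n : ℤ, n ∉ ({-1, 0, 1} : Finset ℤ) →
        ((fun R' => hopping 0 d ε t h (Sum.inr 0) R' ^ 2) ∘ Sum.inr) n = 0 := by
      intro n hn
      simp only [Finset.mem_insert, Finset.mem_singleton, not_or] at hn
      simp only [Function.comp_apply, hopping, intralayer]
      rw [if_neg (by omega), if_neg (by omega), if_neg (by omega)]
      simp
    have h6 := hasSum_sum_of_ne_finset_zero (L := SummationFilter.unconditional ℤ) h3
    have h7 : ∑ n ∈ ({-1, 0, 1} : Finset ℤ),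
        ((fun R' => hopping 0 d ε t h (Sum.inr 0) R' ^ 2) ∘ Sum.inr) n = ε ^ 2 + 2 * t ^ 2 := by
      simp [hopping, intralayer]
      ring
    rwa [h7] at h6
  have h4 : Summable ((fun R' => hopping 0 d ε t h (Sum.inr 0) R' ^ 2) ∘ Sum.inl) :=
    h1.summable.comp_injective Sum.inl_injective
  have h5 := (h4.hasSum.sum h2).unique h1
  rw [← h5, add_sub_cancel_right]
  convert h4.hasSum using 1
  ext n
  simp [hopping]

/-- The image at `θ = 0` determines `ε` and, for each shift of the grid, the second moment. -/
theorem parameters_of_ldosImage_eq {g : Polynomial ℝ} (hg : 2 ≤ g.natDegree) {NE : ℕ}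
    (hNE : g.natDegree < NE) {Emin Emax : ℝ} (hE : Emin < Emax) {hop : ℝ → ℝ → ℝ → ℝ} {Nd : ℕ}
    (p q : Params)
    (hp : ∀ d, ActsBy (hopping 0 d p.1 p.2.1 (hop p.2.2.1 p.2.2.2))
      (hamiltonian 0 d p.1 p.2.1 (hop p.2.2.1 p.2.2.2)))
    (hq : ∀ d, ActsBy (hopping 0 d q.1 q.2.1 (hop q.2.2.1 q.2.2.2))
      (hamiltonian 0 d q.1 q.2.1 (hop q.2.2.1 q.2.2.2)))
    (h : ldosImage g hop Nd NE Emin Emax 0 p = ldosImage g hop Nd NE Emin Emax 0 q) (i : Fin Nd) :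
    p.1 = q.1 ∧
      2 * p.2.1 ^ 2 + ∑' n : ℤ, hop p.2.2.1 p.2.2.2 |shiftGrid Nd i - n| ^ 2 =
        2 * q.2.1 ^ 2 + ∑' n : ℤ, hop q.2.2.1 q.2.2.2 |shiftGrid Nd i - n| ^ 2 := by
  set d := shiftGrid Nd i with hd
  set Hp := hamiltonian 0 d p.1 p.2.1 (hop p.2.2.1 p.2.2.2) with hHp
  set Hq := hamiltonian 0 d q.1 q.2.1 (hop q.2.2.1 q.2.2.2) with hHq
  set c : ℕ → ℝ := fun m => (entry (Hp ^ m) (Sum.inr 0) (Sum.inr 0)).re -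
    (entry (Hq ^ m) (Sum.inr 0) (Sum.inr 0)).re with hc
  have hinj : Function.Injective fun j : Fin NE => -energyGrid NE Emin Emax j := by
    intro j k hjk
    have hN : (0 : ℝ) < NE := by exact_mod_cast (by omega : 0 < NE)
    have h1 : Emax - Emin ≠ 0 := by linarith
    simp only [energyGrid, neg_inj, add_right_inj] at hjk
    rw [div_left_inj' hN.ne', mul_left_inj' h1] at hjk
    exact Fin.ext (by exact_mod_cast hjk)
  have hcz := coeff_eq_zero_of_sum_hasseDeriv_eval_eq_zero hg (c := c) (by simp [hc])
    (by simpa using hNE) hinj (fun j => by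
      have h1 : ldosImage g hop Nd NE Emin Emax 0 p (i, j) =
        ldosImage g hop Nd NE Emin Emax 0 q (i, j) := by rw [h]
      simp only [ldosImage] at h1
      rw [ldos_eq_sum g one_pos, ldos_eq_sum g one_pos, ← sub_eq_zero,
        ← Finset.sum_sub_distrib] at h1
      simpa only [hc, mul_sub] using h1)
  have h1 : p.1 = q.1 := by
    have h2 := hcz.1
    simp only [hc, pow_one] at h2
    rw [hHp, hHq, entry_of_actsBy (hp d), entry_of_actsBy (hq d)] at h2
    simpa [hopping, intralayer, sub_eq_zero] using h2
  refine ⟨h1, ?_⟩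
  rw [(hasSum_sq_hop (hp d)).tsum_eq, (hasSum_sq_hop (hq d)).tsum_eq]
  have h2 := hcz.2
  simp only [hc] at h2
  rw [← hHp, ← hHq, h1]
  linarith

/-! ### Exponential interlayer hopping -/

/-- Two geometric series, one for the sites on either side of the shift. -/
theorem hasSum_sq_expHop {ν l d : ℝ} (hl : 0 < l) (hd0 : 0 ≤ d) (hd1 : d ≤ 1) :
    HasSum (fun n : ℤ => expHop ν l |d - n| ^ 2)
      (ν ^ 2 / (1 - Real.exp (-2 / l)) *
        (Real.exp (-2 * d / l) + Real.exp (-2 * (1 - d) / l))) := by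
  set q := Real.exp (-2 / l) with hq
  have hq1 : q < 1 := Real.exp_lt_one_iff.2 (div_neg_of_neg_of_pos (by norm_num) hl)
  have hgeom := hasSum_geometric_of_lt_one (Real.exp_pos _).le hq1
  have hterm : ∀ (c : ℝ) (n : ℕ), 0 ≤ c → expHop ν l (c + n) ^ 2 =
      ν ^ 2 * Real.exp (-2 * c / l) * q ^ n := by
    intro c n hc
    rw [expHop, abs_of_nonneg (by positivity), hq, ← Real.exp_nat_mul, mul_pow, ← Real.exp_nat_mul,
      mul_assoc, ← Real.exp_add]
    congr 2
    push_cast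
    ring
  rw [← (Equiv.neg ℤ).hasSum_iff]
  have h1 : HasSum (fun n : ℕ => expHop ν l |d - ((-(n : ℤ) : ℤ) : ℝ)| ^ 2)
      (ν ^ 2 * Real.exp (-2 * d / l) * (1 - q)⁻¹) := by
    refine (hgeom.mul_left _).congr_fun fun n => ?_
    push_cast
    rw [sub_neg_eq_add, abs_of_nonneg (by positivity), hterm d n hd0]
  have h2 : HasSum (fun n : ℕ => expHop ν l |d - ((-(-((n : ℤ) + 1)) : ℤ) : ℝ)| ^ 2)
      (ν ^ 2 * Real.exp (-2 * (1 - d) / l) * (1 - q)⁻¹) := by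
    refine (hgeom.mul_left _).congr_fun fun n => ?_
    push_cast
    rw [neg_neg, abs_sub_comm, show (n : ℝ) + 1 - d = (1 - d) + n by ring,
      abs_of_nonneg (add_nonneg (sub_nonneg.2 hd1) n.cast_nonneg), hterm _ n (sub_nonneg.2 hd1)]
  convert HasSum.of_nat_of_neg_add_one (f := (fun n : ℤ => expHop ν l |d - n| ^ 2) ∘ Equiv.neg ℤ)
    h1 h2 using 1
  ring

/-- The values at the shifts `0, 1/4, 1/2`, with `z = exp (-1 / (2 l))`, determine the parameters:
the differences to the last value are `a (1 - z ^ 2) ^ 2` and `a z (1 - z) ^ 2`, and their ratio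
`z + 2 + 1 / z` is injective on `(0, 1)`. -/
theorem eq_of_three_shifts {z z' a a' T T' : ℝ} (hz : 0 < z) (hz1 : z < 1) (hz' : 0 < z')
    (hz1' : z' < 1) (ha : 0 < a) (ha' : 0 < a')
    (h0 : T + a * (1 + z ^ 4) = T' + a' * (1 + z' ^ 4))
    (h1 : T + a * (z + z ^ 3) = T' + a' * (z' + z' ^ 3))
    (h2 : T + a * (z ^ 2 + z ^ 2) = T' + a' * (z' ^ 2 + z' ^ 2)) :
    z = z' ∧ a = a' ∧ T = T' := by
  have e1 : a * (1 - z ^ 2) ^ 2 = a' * (1 - z' ^ 2) ^ 2 := by linarith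
  have e2 : a * (z * (1 - z) ^ 2) = a' * (z' * (1 - z') ^ 2) := by linarith
  have e3 : (a * (1 - z ^ 2) ^ 2) * (a' * (z' * (1 - z') ^ 2)) =
      (a' * (1 - z' ^ 2) ^ 2) * (a * (z * (1 - z) ^ 2)) := by rw [e1, e2]
  have e4 : a * a' * (1 - z) ^ 2 * (1 - z') ^ 2 * ((z' - z) * (1 - z * z')) = 0 := by
    linear_combination e3
  have p1 : 0 < 1 - z := by linarith
  have p2 : 0 < 1 - z' := by linarith
  have p3 : 0 < 1 - z * z' := by nlinarith
  have hzz : z = z' := by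
    have h3 : a * a' * (1 - z) ^ 2 * (1 - z') ^ 2 ≠ 0 := by positivity
    rcases mul_eq_zero.1 ((mul_eq_zero.1 e4).resolve_left h3) with h | h <;> linarith
  subst hzz
  have haa : a = a' := by
    have h3 : z * (1 - z) ^ 2 ≠ 0 := by positivity
    exact mul_right_cancel₀ h3 e2
  subst haa
  exact ⟨rfl, rfl, by linarith⟩

theorem injective_untwistedMap_expHop {g : Polynomial ℝ} (hg : 2 ≤ g.natDegree) {NE : ℕ}
    (hNE : g.natDegree < NE) {Emin Emax : ℝ} (hE : Emin < Emax) {Nd : ℕ}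
    (hNd : {0, 1 / 4, 1 / 2} ⊆ Set.range (shiftGrid Nd)) {P : Set Params} (hP : Admissible P) :
    Function.Injective (untwistedMap g expHop Nd NE Emin Emax P) := by
  rintro ⟨p, hp⟩ ⟨q, hq⟩ hpq
  obtain ⟨hpt, hpν, hpl⟩ := hP p hp
  obtain ⟨hqt, hqν, hql⟩ := hP q hq
  have key := parameters_of_ldosImage_eq hg hNE hE p q
    (fun d => actsBy_hamiltonian_expHop one_pos d _ _ hpν hpl)
    (fun d => actsBy_hamiltonian_expHop one_pos d _ _ hqν hql) hpq
  have hsum : ∀ d ∈ ({0, 1 / 4, 1 / 2} : Set ℝ), 0 ≤ d → d ≤ 1 →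
      2 * p.2.1 ^ 2 + p.2.2.1 ^ 2 / (1 - Real.exp (-2 / p.2.2.2)) *
          (Real.exp (-2 * d / p.2.2.2) + Real.exp (-2 * (1 - d) / p.2.2.2)) =
        2 * q.2.1 ^ 2 + q.2.2.1 ^ 2 / (1 - Real.exp (-2 / q.2.2.2)) *
          (Real.exp (-2 * d / q.2.2.2) + Real.exp (-2 * (1 - d) / q.2.2.2)) := by
    intro d hd h0 h1
    obtain ⟨i, hi⟩ := hNd hd
    have h2 := (key i).2
    rw [hi, (hasSum_sq_expHop hpl h0 h1).tsum_eq, (hasSum_sq_expHop hql h0 h1).tsum_eq] at h2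
    exact h2
  have h0 := hsum 0 (by simp) le_rfl one_pos.le
  have h1 := hsum (1 / 4) (by simp) (by norm_num) (by norm_num)
  have h2 := hsum (1 / 2) (by simp) (by norm_num) (by norm_num)
  have hz : ∀ (l d : ℝ) (k : ℕ), 0 < l → 4 * d = k →
      Real.exp (-2 * d / l) = Real.exp (-(1 / (2 * l))) ^ k := by
    intro l d k hl hk
    rw [← Real.exp_nat_mul, ← hk]
    congr 1
    field_simp
    ring
  have hz4 : ∀ l : ℝ, 0 < l → Real.exp (-2 / l) = Real.exp (-(1 / (2 * l))) ^ 4 := by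
    intro l hl
    simpa using hz l 1 4 hl (by norm_num)
  have hexp1 : ∀ l : ℝ, 0 < l → Real.exp (-2 / l) < 1 := fun l hl =>
    Real.exp_lt_one_iff.2 (div_neg_of_neg_of_pos (by norm_num) hl)
  rw [hz _ 0 0 hpl (by norm_num), hz _ (1 - 0) 4 hpl (by norm_num), hz _ 0 0 hql (by norm_num),
    hz _ (1 - 0) 4 hql (by norm_num), pow_zero, pow_zero] at h0
  rw [hz _ (1 / 4) 1 hpl (by norm_num), hz _ (1 - 1 / 4) 3 hpl (by norm_num),
    hz _ (1 / 4) 1 hql (by norm_num), hz _ (1 - 1 / 4) 3 hql (by norm_num), pow_one, pow_one] at h1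
  rw [hz _ (1 / 2) 2 hpl (by norm_num), hz _ (1 - 1 / 2) 2 hpl (by norm_num),
    hz _ (1 / 2) 2 hql (by norm_num), hz _ (1 - 1 / 2) 2 hql (by norm_num)] at h2
  obtain ⟨e1, e2, e3⟩ := eq_of_three_shifts (Real.exp_pos _)
    (Real.exp_lt_one_iff.2 (neg_neg_of_pos (by positivity))) (Real.exp_pos _)
    (Real.exp_lt_one_iff.2 (neg_neg_of_pos (by positivity)))
    (div_pos (by positivity) (sub_pos.2 (hexp1 _ hpl)))
    (div_pos (by positivity) (sub_pos.2 (hexp1 _ hql))) h0 h1 h2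
  have hl : p.2.2.2 = q.2.2.2 := by
    have h3 := Real.exp_injective e1
    rw [neg_inj, one_div, one_div, inv_inj] at h3
    linarith
  have hν : p.2.2.1 = q.2.2.1 := by
    rw [hl, div_left_inj' (sub_pos.2 (hexp1 _ hql)).ne'] at e2
    exact (pow_left_inj₀ hpν.le hqν.le two_ne_zero).1 e2
  have ht : p.2.1 = q.2.1 := (pow_left_inj₀ hpt.le hqt.le two_ne_zero).1 (by linarith)
  obtain ⟨i, -⟩ := hNd (show (0 : ℝ) ∈ _ by simp)
  exact Subtype.ext (Prod.ext (key i).1 (Prod.ext ht (Prod.ext hν hl)))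

/-! ### Truncated analytic interlayer hopping -/

/-- For shifts in `(0, 1)` the second moment is a finite sum over sites that do not depend on the
shift. -/
theorem tsum_sq_truncHop {f : ℝ → ℝ} (heven : ∀ x, f (-x) = f x) (r₀ : ℕ) (ν l : ℝ) {d : ℝ}
    (hd0 : 0 < d) (hd1 : d < 1) :
    ∑' n : ℤ, truncHop f r₀ ν l |d - n| ^ 2 =
      ∑ n ∈ Finset.Icc (-r₀ : ℤ) (r₀ + 1), (ν * f ((d - n) / l)) ^ 2 := by
  rw [tsum_eq_sum (s := Finset.Icc (-r₀ : ℤ) (r₀ + 1))]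
  · refine Finset.sum_congr rfl fun n hn => ?_
    rw [Finset.mem_Icc] at hn
    have h1 : (-r₀ : ℝ) ≤ n := by exact_mod_cast hn.1
    have h2 : (n : ℝ) ≤ r₀ + 1 := by exact_mod_cast hn.2
    have h3 : |d - n| ∈ Set.Ico (-(r₀ : ℝ)) (r₀ + 1) :=
      ⟨(neg_nonpos.2 r₀.cast_nonneg).trans (abs_nonneg _), abs_lt.2 ⟨by linarith, by linarith⟩⟩
    rw [truncHop, Set.indicator_of_mem h3, Pi.one_apply, mul_one]
    rcases abs_choice (d - n) with h | h <;> rw [h]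
    rw [neg_div, heven]
  · intro n hn
    rw [Finset.mem_Icc, not_and_or, not_le, not_le] at hn
    have h3 : |d - n| ∉ Set.Ico (-(r₀ : ℝ)) (r₀ + 1) := by
      intro h
      have h4 := abs_lt.1 h.2
      rcases hn with hn | hn
      · have h5 : (n : ℝ) + 1 ≤ -r₀ := by exact_mod_cast hn
        linarith
      · have h5 : (r₀ : ℝ) + 1 + 1 ≤ n := by exact_mod_cast hn
        linarith
    rw [truncHop, Set.indicator_of_notMem h3]
    simp

/-- The ratio condition with `l = 1/2`, `l' = 1` makes `x * f x` bounded at infinity. -/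
theorem tendsto_zero_of_ratio {f : ℝ → ℝ} (hf : Continuous f) (hpos : ∀ x, 0 < f x)
    (hratio : Filter.Tendsto (fun r => f (r / (1 / 2)) / f (r / 1)) Filter.atTop (nhds 0)) :
    Filter.Tendsto f Filter.atTop (nhds 0) := by
  obtain ⟨R, hR⟩ := Filter.eventually_atTop.1
    (hratio.eventually (gt_mem_nhds (by norm_num : (0 : ℝ) < 1 / 2)))
  set S := max R 1 with hS
  have hS0 : 0 < S := lt_of_lt_of_le one_pos (le_max_right _ _)
  have hhalf : ∀ x, S ≤ x → f (2 * x) ≤ f x / 2 := by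
    intro x hx
    have h1 := hR x ((le_max_left _ _).trans hx)
    rw [div_one, div_lt_iff₀ (hpos x), show x / (1 / 2) = 2 * x by ring] at h1
    linarith
  obtain ⟨B, hB⟩ := (isCompact_Icc (a := S) (b := 2 * S)).exists_bound_of_continuousOn
    (f := fun x => x * f x) (by fun_prop)
  have hbound : ∀ (k : ℕ) x, S ≤ x → x ≤ 2 ^ (k + 1) * S → x * f x ≤ B := by
    intro k
    induction k with
    | zero => exact fun x h1 h2 => (le_abs_self _).trans (hB x ⟨h1, by simpa using h2⟩)
    | succ k ih =>
      intro x h1 h2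
      by_cases hx : x ≤ 2 * S
      · exact (le_abs_self _).trans (hB x ⟨h1, hx⟩)
      · have h3 : S ≤ x / 2 := by linarith
        have h4 := ih (x / 2) h3 (by rw [pow_succ] at h2; linarith)
        have h5 := hhalf (x / 2) h3
        rw [show 2 * (x / 2) = x by ring] at h5
        nlinarith
  have hall : ∀ x, S ≤ x → x * f x ≤ B := by
    intro x hx
    obtain ⟨k, hk⟩ := pow_unbounded_of_one_lt (x / S) (one_lt_two : (1 : ℝ) < 2)
    refine hbound k x hx ?_
    rw [div_lt_iff₀ hS0] at hk
    rw [pow_succ]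
    nlinarith [pow_pos (two_pos : (0 : ℝ) < 2) k]
  refine squeeze_zero' (Filter.Eventually.of_forall fun x => (hpos x).le) ?_
    (tendsto_const_nhds.div_atTop Filter.tendsto_id : Filter.Tendsto (fun x : ℝ => B / x) _ _)
  filter_upwards [Filter.eventually_ge_atTop S] with x hx
  rw [le_div_iff₀ (hS0.trans_le hx), mul_comm]
  exact hall x hx

theorem tendsto_sub_div_atTop (c : ℝ) {l : ℝ} (hl : 0 < l) :
    Filter.Tendsto (fun x : ℝ => (x - c) / l) Filter.atTop Filter.atTop :=
  (Filter.tendsto_atTop_add_const_right _ (-c) Filter.tendsto_id).atTop_div_const hl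

/-- A profile with the smaller length scale is negligible, hence cannot be a multiple of a profile
with the larger one. -/
theorem not_lt_of_sum_sq_eq {f : ℝ → ℝ} (hpos : ∀ x, 0 < f x)
    (hratio : ∀ l l' : ℝ, 0 < l → l < l' →
      Filter.Tendsto (fun r => f (r / l) / f (r / l')) Filter.atTop (nhds 0))
    {s : Finset ℤ} (hs : s.Nonempty) {ν ν' l l' : ℝ} (hν : 0 < ν) (hν' : 0 < ν') (hl : 0 < l)
    (h : ∀ x : ℝ, ∑ n ∈ s, (ν * f ((x - n) / l)) ^ 2 = ∑ n ∈ s, (ν' * f ((x - n) / l')) ^ 2) :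
    ¬ l < l' := by
  intro hll
  have hev : ∀ᶠ x in Filter.atTop, ∀ n ∈ s, ν * f ((x - n) / l) < ν' * f ((x - n) / l') := by
    rw [Filter.eventually_all_finset]
    intro n _
    have h1 : Filter.Tendsto (fun x : ℝ => x - n) Filter.atTop Filter.atTop := by
      simpa using tendsto_sub_div_atTop n one_pos
    have h2 := ((hratio l l' hl hll).comp h1).eventually (gt_mem_nhds (div_pos hν' hν))
    filter_upwards [h2] with x hx
    simp only [Function.comp_apply] at hx
    rw [div_lt_div_iff₀ (hpos _) hν] at hx
    linarith
  obtain ⟨x, hx⟩ := hev.exists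
  refine (Finset.sum_lt_sum_of_nonempty hs fun n hn => ?_).ne (h x)
  have := hx n hn
  have := mul_pos hν (hpos ((x - n) / l))
  gcongr

theorem eq_of_sum_sq_eq {f : ℝ → ℝ} (hf : Continuous f) (hpos : ∀ x, 0 < f x)
    (hratio : ∀ l l' : ℝ, 0 < l → l < l' →
      Filter.Tendsto (fun r => f (r / l) / f (r / l')) Filter.atTop (nhds 0))
    {s : Finset ℤ} (hs : s.Nonempty) {T T' ν ν' l l' : ℝ} (hν : 0 < ν) (hν' : 0 < ν')
    (hl : 0 < l) (hl' : 0 < l')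
    (h : ∀ x : ℝ, T + ∑ n ∈ s, (ν * f ((x - n) / l)) ^ 2 =
      T' + ∑ n ∈ s, (ν' * f ((x - n) / l')) ^ 2) :
    T = T' ∧ ν = ν' ∧ l = l' := by
  have hf0 := tendsto_zero_of_ratio hf hpos (hratio (1 / 2) 1 (by norm_num) (by norm_num))
  have hlim : ∀ T ν l : ℝ, 0 < l → Filter.Tendsto
      (fun x : ℝ => T + ∑ n ∈ s, (ν * f ((x - n) / l)) ^ 2) Filter.atTop (nhds T) := by
    intro T ν l hl
    have h1 : Filter.Tendsto (fun x : ℝ => ∑ n ∈ s, (ν * f ((x - n) / l)) ^ 2) Filter.atTop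
        (nhds (∑ n ∈ s, (ν * 0) ^ 2)) :=
      tendsto_finsetSum _ fun n _ =>
        ((hf0.comp (tendsto_sub_div_atTop n hl)).const_mul ν).pow 2
    simpa using h1.const_add T
  have hT : T = T' := by
    have h1 := hlim T ν l hl
    simp only [h] at h1
    exact tendsto_nhds_unique h1 (hlim T' ν' l' hl')
  subst hT
  have h' : ∀ x : ℝ, ∑ n ∈ s, (ν * f ((x - n) / l)) ^ 2 = ∑ n ∈ s, (ν' * f ((x - n) / l')) ^ 2 :=
    fun x => add_left_cancel (h x)
  have hll : l = l' := le_antisymm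
    (not_lt.1 (not_lt_of_sum_sq_eq hpos hratio hs hν' hν hl' fun x => (h' x).symm))
    (not_lt.1 (not_lt_of_sum_sq_eq hpos hratio hs hν hν' hl h'))
  subst hll
  refine ⟨rfl, ?_, rfl⟩
  have h1 := h' 0
  simp only [mul_pow, ← Finset.mul_sum] at h1
  have h2 : 0 < ∑ n ∈ s, f ((0 - (n : ℝ)) / l) ^ 2 :=
    Finset.sum_pos (fun n _ => pow_pos (hpos _) 2) hs
  exact (pow_left_inj₀ hν.le hν'.le two_ne_zero).1 (mul_right_cancel₀ h2.ne' h1)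

/-- Fine grids of shifts have a point in any nonempty open subset of `(0, 1)`. -/
theorem eventually_exists_shiftGrid_mem {U : Set ℝ} (hU : IsOpen U) {x : ℝ} (hx : x ∈ U)
    (hx0 : 0 < x) (hx1 : x < 1) :
    ∀ᶠ N : ℕ in Filter.atTop, ∃ i : Fin N,
      shiftGrid N i ∈ U ∧ 0 < shiftGrid N i ∧ shiftGrid N i < 1 := by
  have hlim : Filter.Tendsto (fun N : ℕ => (⌊x * N⌋₊ : ℝ) / N) Filter.atTop (nhds x) :=
    (tendsto_nat_floor_mul_div_atTop hx0.le).comp tendsto_natCast_atTop_atTop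
  filter_upwards [hlim.eventually (hU.mem_nhds hx), hlim.eventually (lt_mem_nhds hx0),
    hlim.eventually (gt_mem_nhds hx1), Filter.eventually_gt_atTop 0] with N h1 h2 h3 hN
  have hN' : (0 : ℝ) < N := by exact_mod_cast hN
  have h4 : ⌊x * N⌋₊ < N := by
    rw [div_lt_one hN'] at h3
    exact_mod_cast h3
  exact ⟨⟨_, h4⟩, h1, h2, h3⟩

/-- Distinct parameters have distinct images on all fine grids.  The second moments are analytic in
the shift, and the behaviour of their continuations at infinity separates the parameters; hence they
differ on a nonempty open subset of `(0, 1)`. -/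
theorem eventually_ldosImage_ne {g : Polynomial ℝ} (hg : 2 ≤ g.natDegree) {NE : ℕ}
    (hNE : g.natDegree < NE) {Emin Emax : ℝ} (hE : Emin < Emax) {f : ℝ → ℝ}
    (hf : AnalyticOnNhd ℝ f Set.univ) (hpos : ∀ x, 0 < f x) (heven : ∀ x, f (-x) = f x)
    (hratio : ∀ l l' : ℝ, 0 < l → l < l' →
      Filter.Tendsto (fun r => f (r / l) / f (r / l')) Filter.atTop (nhds 0))
    (r₀ : ℕ) {p q : Params} (hp : 0 < p.2.1 ∧ 0 < p.2.2.1 ∧ 0 < p.2.2.2)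
    (hq : 0 < q.2.1 ∧ 0 < q.2.2.1 ∧ 0 < q.2.2.2) (hpq : p ≠ q) :
    ∀ᶠ Nd : ℕ in Filter.atTop, ldosImage g (truncHop f r₀) Nd NE Emin Emax 0 p ≠
      ldosImage g (truncHop f r₀) Nd NE Emin Emax 0 q := by
  have hfc : Continuous f := continuousOn_univ.1 hf.continuousOn
  have hact : ∀ (p : Params) (d : ℝ), ActsBy
      (hopping 0 d p.1 p.2.1 (truncHop f r₀ p.2.2.1 p.2.2.2))
      (hamiltonian 0 d p.1 p.2.1 (truncHop f r₀ p.2.2.1 p.2.2.2)) := fun p d =>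
    actsBy_hamiltonian one_pos d _ _ one_pos (truncHop_decay hfc r₀ _ _).choose_spec
  have key : ∀ {Nd : ℕ}, ldosImage g (truncHop f r₀) Nd NE Emin Emax 0 p =
      ldosImage g (truncHop f r₀) Nd NE Emin Emax 0 q → ∀ i : Fin Nd, _ := fun h i =>
    parameters_of_ldosImage_eq hg hNE hE p q (hact p) (hact q) h i
  by_cases hε : p.1 = q.1
  swap
  · filter_upwards [Filter.eventually_gt_atTop 0] with Nd hNd h
    exact hε (key h ⟨0, hNd⟩).1
  set s : Finset ℤ := Finset.Icc (-r₀ : ℤ) (r₀ + 1) with hs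
  set D : Params → ℝ → ℝ := fun p x =>
    2 * p.2.1 ^ 2 + ∑ n ∈ s, (p.2.2.1 * f ((x - n) / p.2.2.2)) ^ 2 with hD
  have hDa : ∀ p, AnalyticOnNhd ℝ (D p) Set.univ := by
    intro p x _
    refine analyticAt_const.add (Finset.analyticAt_fun_sum _ fun n _ => ?_)
    refine (analyticAt_const.mul ?_).pow 2
    exact (hf _ (Set.mem_univ _)).fun_comp ((analyticAt_id.sub analyticAt_const).div_const)
  obtain ⟨x, hx0, hx1, hx⟩ : ∃ x, 0 < x ∧ x < 1 ∧ D p x ≠ D q x := by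
    by_contra! hall
    have heq : D p = D q := by
      refine (hDa p).eq_of_eventuallyEq (hDa q) (z₀ := 1 / 2) ?_
      filter_upwards [Ioo_mem_nhds (by norm_num : (0 : ℝ) < 1 / 2) (by norm_num : (1 / 2 : ℝ) < 1)]
        with x hx using hall x hx.1 hx.2
    obtain ⟨e1, e2, e3⟩ := eq_of_sum_sq_eq hfc hpos hratio
      (s := s) ⟨0, Finset.mem_Icc.2 ⟨by omega, by omega⟩⟩ hp.2.1 hq.2.1 hp.2.2 hq.2.2
      (fun x => congrFun heq x)
    have ht : p.2.1 = q.2.1 := (pow_left_inj₀ hp.1.le hq.1.le two_ne_zero).1 (by linarith)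
    exact hpq (Prod.ext hε (Prod.ext ht (Prod.ext e2 e3)))
  have hDc : ∀ p, Continuous (D p) := fun p => continuousOn_univ.1 (hDa p).continuousOn
  filter_upwards [eventually_exists_shiftGrid_mem (isOpen_ne_fun (hDc p) (hDc q)) hx hx0 hx1]
    with Nd ⟨i, hi, hi0, hi1⟩ h
  refine hi ?_
  have h1 := (key h i).2
  rwa [tsum_sq_truncHop heven r₀ _ _ hi0 hi1, tsum_sq_truncHop heven r₀ _ _ hi0 hi1] at h1

/-- The restriction to the real line of a complex analytic function. -/
theorem analyticOnNhd_real_of_complex {D : Set ℂ} {F : ℂ → ℂ} {f : ℝ → ℝ}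
    (hD : ∀ x : ℝ, (x : ℂ) ∈ D) (hF : AnalyticOnNhd ℂ F D) (hFf : ∀ x : ℝ, F x = f x) :
    AnalyticOnNhd ℝ f Set.univ := by
  intro x _
  have h1 := (hF x (hD x)).re_ofReal
  simpa [hFf] using h1

/-! ### Universal approximation of twist operators -/

theorem theorem5p2
    (g : Polynomial ℝ) (hg : 2 ≤ g.natDegree)
    (NE : ℕ) (hNE : g.natDegree < NE) (Emin Emax : ℝ) (hE : Emin < Emax) :
    -- exponential interlayer hopping, compact parameter set
    (∀ (Nd : ℕ), 3 ≤ Nd → {0, 1 / 4, 1 / 2} ⊆ Set.range (shiftGrid Nd) →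
      ∀ P : Set Params, IsCompact P → Admissible P →
        ∃ hK : Function.Injective (untwistedMap g expHop Nd NE Emin Emax P),
          ∀ θ : ℝ, 0 ≤ θ → θ < 1 →
            ApproximableByTwoLayerNets (twistOperator g expHop Nd NE Emin Emax θ P hK)) ∧
    -- truncated analytic interlayer hopping, finite parameter set, fine enough grid of shifts
    (∀ (f : ℝ → ℝ) (D : Set ℂ) (F : ℂ → ℂ) (r₀ : ℕ), 1 < r₀ →
      IsOpen D → IsConnected D → (∀ x : ℝ, (x : ℂ) ∈ D) → AnalyticOnNhd ℂ F D →
      (∀ x : ℝ, F x = f x) → (∀ x, 0 < f x) → (∀ x, f (-x) = f x) →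
      (∀ l l' : ℝ, 0 < l → l < l' →
        Filter.Tendsto (fun r => f (r / l) / f (r / l')) Filter.atTop (nhds 0)) →
      ∀ P : Set Params, P.Finite → Admissible P →
        ∃ N₀ : ℕ, 0 < N₀ ∧ ∀ Nd : ℕ, N₀ < Nd →
          ∃ hK : Function.Injective (untwistedMap g (truncHop f r₀) Nd NE Emin Emax P),
            ∀ θ : ℝ, 0 ≤ θ → θ < 1 →
              ApproximableByTwoLayerNets
                (twistOperator g (truncHop f r₀) Nd NE Emin Emax θ P hK)) := by
  constructor
  · intro Nd _ hNd P hPc hP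
    exact ⟨injective_untwistedMap_expHop hg hNE hE hNd hP, fun θ h0 h1 =>
      approximable_twistOperator hPc _
        (fun _ _ h => continuous_ldosImage_expHop g Nd NE Emin Emax h hP) h0 h1⟩
  · intro f D F r₀ _ _ _ hD hF hFf hpos heven hratio P hPf hP
    have hf := analyticOnNhd_real_of_complex hD hF hFf
    have hev : ∀ᶠ Nd : ℕ in Filter.atTop, ∀ p ∈ P, ∀ q ∈ P, p ≠ q →
        ldosImage g (truncHop f r₀) Nd NE Emin Emax 0 p ≠
          ldosImage g (truncHop f r₀) Nd NE Emin Emax 0 q := by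
      rw [Filter.eventually_all_finite hPf]
      intro p hp
      rw [Filter.eventually_all_finite hPf]
      intro q hq
      by_cases hpq : p = q
      · exact Filter.Eventually.of_forall fun _ h => absurd hpq h
      · filter_upwards [eventually_ldosImage_ne hg hNE hE hf hpos heven hratio r₀ (hP p hp)
          (hP q hq) hpq] with Nd h _ using h
    obtain ⟨N, hN⟩ := Filter.eventually_atTop.1 hev
    refine ⟨N + 1, Nat.succ_pos _, fun Nd hNd => ⟨?_, fun θ h0 h1 => ?_⟩⟩
    · rintro ⟨p, hp⟩ ⟨q, hq⟩ hpq
      by_contra hne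
      exact hN Nd (by omega) p hp q hq (fun h => hne (Subtype.ext h)) hpq
    · have : Finite P := hPf
      exact approximable_twistOperator hPf.isCompact _
        (fun _ _ _ => continuous_of_discreteTopology) h0 h1
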